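/- **Setting.** Terms of the linear substitution calculus (LSC), up to $\alpha$-equivalence: $t,u,r,p ::= x \mid \lambda x.t \mid t\,u \mid t[x{\leftarrow}u]$, where $t[x{\leftarrow}u]$ (an explicit substitution, ES) binds $x$ in $t$; $|t|$ is the number of constructors of $t$. General contexts: $C ::= \langle\cdot\rangle \mid \lambda x.C \mid C\,t \mid t\,C \mid C[x{\leftarrow}t] \mid t[x{\leftarrow}C]$; a context is *shallow* if the last production is not used; substitution contexts are $L ::= \langle\cdot\rangle \mid L[x{\leftarrow}t]$. Plugging $C\langle t\rangle$ may capture variables. The rules are $$L\langle\lambda x.t\rangle\,u \to_{\mathtt{dB}} L\langle t[x{\leftarrow}u]\rangle,\qquad C\langle x\rangle[x{\leftarrow}u]\to_{\mathtt{ls}} C\langle u\rangle[x{\leftarrow}u]\ \ (C\text{ not capturing }x\text{ or free variables of }u),$$ closed under contexts. The $\mathtt{ls}$-step *duplicates* $u$. A *redex* is identified with its *position*: the context of the $\mathtt{dB}$-redex, or the context of the replaced occurrence of $x$ for $\mathtt{ls}$. A redex is shallow if its position is; a *derivation* $\rho:t\to^k u$ is a sequence of $k$ steps contracting shallow redexes.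 The order $C\prec_{LO}D$ on contexts holds if $D=C\langle D'\rangle$ with $D'\neq\langle\cdot\rangle$, or if, for some $E$, either $C=E\langle C'r\rangle$ and $D=E\langle tD'\rangle$, or $C=E\langle C'[x{\leftarrow}r]\rangle$ and $D=E\langle t[x{\leftarrow}D']\rangle$, where $C'$ is a prefix of $t$ and $D'$ a prefix of $r$ (a context is a prefix of a term if some plugging of it yields that term). Residuals of redexes are defined by tracing the application of a $\mathtt{dB}$-redex, respectively the variable occurrence of an $\mathtt{ls}$-redex, along steps. A derivation $C_1;\dots;C_n$ is *standard* if for all $j<i$ the redex $C_i$ is not a residual, after $C_j;\dots;C_{i-1}$, of an LSC redex $D$ (shallow or not) with $D\prec_{LO}C_j$. The unfolding $t{\downarrow}$ carries out all ES of $t$; the unfolding $t{\downarrow_C}$ of $t$ relative to a shallow $C$ is $t{\downarrow}$ in which, moreover, the (unfolded) ES of $C$ having the hole in their scope are carried out. A shallow redex is *useful* if it is a $\mathtt{dB}$-redex, or an $\mathtt{ls}$-redex with position $C$ substituting $u$ such that $u{\downarrow_C}$ contains a $\beta$-redex, or $u{\downarrow_C}$ is an abstraction and $C$ has the form $C'\langle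 L\,t\rangle$. A derivation is *LOU* if each of its steps contracts the $\prec_{LO}$-least useful redex (the LOU redex). A *box context* is a general context whose hole is the argument of an application or the content of an ES; $u$ is a *box subterm* of $t$ if $t=B\langle u\rangle$ for a box context $B$. Being a (box) subterm of $t$ is meant up to variable names: after replacing all variables in both terms by one fixed symbol. A derivation from $t$ has the *subterm property* if every term duplicated along it is a subterm of $t$. **Statement.** 1. (Invariant.) Let $\rho:t_0\to^k t_k\to t_{k+1}$ be a standard derivation, $k\ge 0$, with last contracted redex $C_k$, and let $B$ be a box context with $t_{k+1}=B\langle u\rangle$ and $C_k\prec_{LO}B$. Then $u$ is a box subterm of $t_0$. 2. In every standard derivation $\rho:t\to^k u$, every $\mathtt{ls}$-step duplicates a subterm of $t$; that is, $\rho$ has the subterm property. 3. Every LOU derivation, from any LSC term, has the subterm property. 4. (Linear size.) If $\rho:t\to^k u$ has the subterm property, in particular if it is standard or LOU, then $|u|\le (k+1)\cdot|t|$. 5. (Linear step.) There are one pointer-machine program and one constant $c$ such that, for every derivation $\rho$ from a term $t$ that has the subterm property, in particular for every standard and every LOU derivation, the program implements each step of $\rho$ in time at most $c\cdot|t|$;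 moreover, if $\rho:t\to^k u$ is LOU, it implements the LOU redex of $u$ (if there is one) in time at most $c\cdot|t|$. Here terms are stored as trees of records with one record per constructor, with references to children, to the parent, and from each variable to its binder; the program receives a reference to the application and to the abstraction of a $\mathtt{dB}$-redex, or to the variable occurrence of an $\mathtt{ls}$-redex, and has to turn the memory representing the source of the step into a memory representing its target; following, comparing or storing a reference, allocating a record, and calling a (recursive) procedure each cost one unit of time. -/

import Mathlib

namespace LSC

/-! ### Terms of the linear substitution calculus

Terms are taken modulo renaming of bound variables, that is, in de Bruijn form. -/

/-- Terms: variables, abstractions, applications and explicit substitutions.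
`sub t u` is the explicit substitution of `u` for `x` in `t`; it binds the index `0` of `t`,
as `lam t` does. -/
inductive Term : Type
  | var : ℕ → Term
  | lam : Term → Term
  | app : Term → Term → Term
  | sub : Term → Term → Term

namespace Term

/-- Add `d` to every index that is at least `c`. -/
def shiftFrom (d : ℕ) : ℕ → Term → Term
  | c, var i => if i < c then var i else var (i + d)
  | c, lam t => lam (shiftFrom d (c + 1) t)
  | c, app t u => app (shiftFrom d c t) (shiftFrom d c u)
  | c, sub t u => sub (shiftFrom d (c + 1) t) (shiftFrom d c u)

/-- The same term, seen under `d` further binders. -/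
def shift (d : ℕ) (t : Term) : Term := shiftFrom d 0 t

/-- Capture-avoiding meta-level substitution of `u` for the index `k`; the binder of `k` is
removed. -/
def subst (u : Term) : ℕ → Term → Term
  | k, var i => if i < k then var i else if i = k then shift k u else var (i - 1)
  | k, lam t => lam (subst u (k + 1) t)
  | k, app t r => app (subst u k t) (subst u k r)
  | k, sub t r => sub (subst u (k + 1) t) (subst u k r)

/-- Number of constructors. -/
def size : Term → ℕ
  | var _ => 1
  | lam t => size t + 1
  | app t u => size t + size u + 1
  | sub t u => size t + size u + 1

/-- The term in which all variables have been replaced by one fixed symbol. -/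
def erase : Term → Term
  | var _ => var 0
  | lam t => lam (erase t)
  | app t u => app (erase t) (erase u)
  | sub t u => sub (erase t) (erase u)

/-- The unfolding: all explicit substitutions are carried out. -/
def unfolding : Term → Term
  | var i => var i
  | lam t => lam (unfolding t)
  | app t u => app (unfolding t) (unfolding u)
  | sub t u => subst (unfolding u) 0 (unfolding t)

end Term

/-! ### Contexts -/

/-- General one-hole contexts. `subL C u` has its hole in the body of the explicit substitution,
`subR t C` has it in the content. -/
inductive Ctx : Type
  | hole : Ctx
  | lam : Ctx → Ctx
  | appL : Ctx → Term → Ctx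
  | appR : Term → Ctx → Ctx
  | subL : Ctx → Term → Ctx
  | subR : Term → Ctx → Ctx

/-- The directions in which a hole can lie below a constructor. -/
inductive Dir : Type
  | lam | fn | arg | body | content

namespace Ctx

/-- Plugging of a term (variables may be captured). -/
def plug : Ctx → Term → Term
  | hole, t => t
  | lam C, t => Term.lam (plug C t)
  | appL C u, t => Term.app (plug C t) u
  | appR u C, t => Term.app u (plug C t)
  | subL C u, t => Term.sub (plug C t) u
  | subR u C, t => Term.sub u (plug C t)

/-- Plugging of a context: `C.comp D` is `C` with `D` in its hole. -/
def comp : Ctx → Ctx → Ctx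
  | hole, D => D
  | lam C, D => lam (comp C D)
  | appL C u, D => appL (comp C D) u
  | appR u C, D => appR u (comp C D)
  | subL C u, D => subL (comp C D) u
  | subR u C, D => subR u (comp C D)

/-- Shallow contexts: the hole is not in the content of an explicit substitution. -/
def Shallow : Ctx → Prop
  | hole => True
  | lam C => Shallow C
  | appL C _ => Shallow C
  | appR _ C => Shallow C
  | subL C _ => Shallow C
  | subR _ _ => False

/-- Number of binders that have the hole in their scope. -/
def depth : Ctx → ℕ
  | hole => 0
  | lam C => depth C + 1
  | appL C _ => depth C
  | appR _ C => depth C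
  | subL C _ => depth C + 1
  | subR _ C => depth C

/-- Number of abstractions that have the hole in their scope. -/
def lams : Ctx → ℕ
  | hole => 0
  | lam C => lams C + 1
  | appL C _ => lams C
  | appR _ C => lams C
  | subL C _ => lams C
  | subR _ C => lams C

/-- The path from the root to the hole. -/
def path : Ctx → List Dir
  | hole => []
  | lam C => Dir.lam :: path C
  | appL C _ => Dir.fn :: path C
  | appR _ C => Dir.arg :: path C
  | subL C _ => Dir.body :: path C
  | subR _ C => Dir.content :: path C

/-- Substitution contexts: a hole under a list of explicit substitutions, outermost first. -/
def ofSubst : List Term → Ctx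
  | [] => hole
  | r :: L => subL (ofSubst L) r

/-- `C` is a prefix of the term `t`. -/
def PrefixOf (C : Ctx) (t : Term) : Prop := ∃ u, C.plug u = t

/-- The outside-in order. -/
inductive OutsideIn : Ctx → Ctx → Prop
  | root (C : Ctx) : C ≠ hole → OutsideIn hole C
  | closure (E C D : Ctx) : OutsideIn C D → OutsideIn (E.comp C) (E.comp D)

/-- The left-to-right order. -/
inductive LeftOf : Ctx → Ctx → Prop
  | app (C D : Ctx) (t u : Term) : C.PrefixOf t → D.PrefixOf u →
      LeftOf (appL C u) (appR t D)
  | sub (C D : Ctx) (t u : Term) : C.PrefixOf t → D.PrefixOf u →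
      LeftOf (subL C u) (subR t D)
  | closure (E C D : Ctx) : LeftOf C D → LeftOf (E.comp C) (E.comp D)

/-- The left-to-right outside-in order. -/
def LO (C D : Ctx) : Prop := OutsideIn C D ∨ LeftOf C D

/-- Box contexts: the hole is the argument of an application or the content of an explicit
substitution. -/
inductive IsBox : Ctx → Prop
  | arg (t : Term) : IsBox (appR t hole)
  | content (t : Term) : IsBox (subR t hole)
  | closure (C B : Ctx) : IsBox B → IsBox (C.comp B)

/-- Applicative contexts. -/
def Applicative (A : Ctx) : Prop :=
  ∃ (C : Ctx) (L : List Term) (t : Term), C.Shallow ∧ A = C.comp (appL (ofSubst L) t)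

/-- The unfolding of `t` relative to the context `C`. The abstractions of `C` stay: the index
`i < C.lams` of the result is the variable of the `i`-th of them, counted from the hole. The clause
for the content of an explicit substitution is not used for shallow contexts. -/
def relUnfolding (t : Term) : Ctx → Term
  | hole => t.unfolding
  | lam C => relUnfolding t C
  | appL C _ => relUnfolding t C
  | appR _ C => relUnfolding t C
  | subL C u => Term.subst u.unfolding C.lams (relUnfolding t C)
  | subR _ C => relUnfolding t C

end Ctx

/-- `u` is a subterm of `t`. -/
def Term.Subterm (u t : Term) : Prop := ∃ C : Ctx, C.plug u = t

/-- `u` is a box subterm of `t`. -/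
def Term.BoxSubterm (u t : Term) : Prop := ∃ B : Ctx, B.IsBox ∧ B.plug u = t

/-- The term `t` contains a beta redex. -/
def Term.HasBeta (t : Term) : Prop :=
  ∃ (C : Ctx) (r p : Term), C.plug (Term.app (Term.lam r) p) = t

/-- The term `t` is an abstraction. -/
def Term.IsAbs (t : Term) : Prop := ∃ r, t = Term.lam r

/-! ### Redexes and reduction steps -/

/-- A redex of the (not necessarily shallow) calculus, together with the term it lives in.
`db C L r p` is the redex `L⟨λ.r⟩ p` in the context `C`.
`ls D E u` is the substitution of `u` for one occurrence of the variable bound by an explicit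
substitution with content `u`: `D` is the context of the explicit substitution and `E` the context
of the occurrence in its body. -/
inductive Redex : Type
  | db (C : Ctx) (L : List Term) (r p : Term) : Redex
  | ls (D E : Ctx) (u : Term) : Redex

namespace Redex

/-- The term before the step. -/
def source : Redex → Term
  | db C L r p => C.plug (Term.app ((Ctx.ofSubst L).plug (Term.lam r)) p)
  | ls D E u => D.plug (Term.sub (E.plug (Term.var E.depth)) u)

/-- The term after the step. -/
def target : Redex → Term
  | db C L r p => C.plug ((Ctx.ofSubst L).plug (Term.sub r (p.shift L.length)))
  | ls D E u => D.plug (Term.sub (E.plug (u.shift (E.depth + 1))) u)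

/-- The position of a redex; for a linear substitution redex it is the context of the
replaced occurrence. -/
def position : Redex → Ctx
  | db C _ _ _ => C
  | ls D E u => D.comp (Ctx.subL E u)

/-- Shallow redexes. -/
def Shallow (R : Redex) : Prop := R.position.Shallow

/-- Useful redexes. The term put into the hole of the position of `ls D E u` is
`u.shift (E.depth + 1)`, that is `u` seen from there. -/
def Useful : Redex → Prop
  | db _ _ _ _ => True
  | ls D E u =>
      (Ctx.relUnfolding (u.shift (E.depth + 1)) (D.comp (Ctx.subL E u))).HasBeta ∨
      ((Ctx.relUnfolding (u.shift (E.depth + 1)) (D.comp (Ctx.subL E u))).IsAbs ∧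
        (D.comp (Ctx.subL E u)).Applicative)

/-- `R` is the leftmost-outermost useful redex of its term. -/
def IsLOU (R : Redex) : Prop :=
  R.Shallow ∧ R.Useful ∧
    ∀ D : Redex, D.Shallow → D.source = R.source → D.Useful → D ≠ R →
      R.position.LO D.position

/-- `Origin S p q`: the constructor at the path `q` of the target of `S` is (a copy of) the
constructor at the path `p` of the source of `S`. Application and abstraction of a `db` redex and
the variable replaced by an `ls` redex disappear. -/
inductive Origin : Redex → List Dir → List Dir → Prop
  | outside (S : Redex) (p : List Dir) : ¬ S.position.path <+: p → Origin S p p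
  | dbSubst (C : Ctx) (L : List Term) (r p : Term) (q : List Dir) :
      ¬ List.replicate L.length Dir.body <+: q →
      Origin (db C L r p) (C.path ++ Dir.fn :: q) (C.path ++ q)
  | dbBody (C : Ctx) (L : List Term) (r p : Term) (q : List Dir) :
      Origin (db C L r p)
        (C.path ++ Dir.fn :: (List.replicate L.length Dir.body ++ Dir.lam :: q))
        (C.path ++ (List.replicate L.length Dir.body ++ Dir.body :: q))
  | dbArg (C : Ctx) (L : List Term) (r p : Term) (q : List Dir) :
      Origin (db C L r p)
        (C.path ++ Dir.arg :: q)
        (C.path ++ (List.replicate L.length Dir.body ++ Dir.content :: q))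
  | lsCopy (D E : Ctx) (u : Term) (q : List Dir) :
      Origin (ls D E u) (D.path ++ Dir.content :: q) ((ls D E u).position.path ++ q)

/-- `Residual σ D D'`: the redex `D'` is a residual of the redex `D` after the sequence `σ` of
steps. A `db` redex is traced by its application, an `ls` redex by its variable occurrence. -/
def Residual : List Redex → Redex → Redex → Prop
  | [], D, D' => D = D'
  | S :: σ, D, D' => ∃ D₁ : Redex, D.source = S.source ∧ D₁.source = S.target ∧
      Origin S D.position.path D₁.position.path ∧ Residual σ D₁ D'

end Redex

/-- `IsDerivation t ρ u`: the sequence `ρ` of shallow redexes leads from `t` to `u`. -/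
inductive IsDerivation : Term → List Redex → Term → Prop
  | nil (t : Term) : IsDerivation t [] t
  | cons (t u : Term) (R : Redex) (ρ : List Redex) : R.Shallow → R.source = t →
      IsDerivation R.target ρ u → IsDerivation t (R :: ρ) u

/-- Standard derivations: no step `R` is a residual of a redex `D` (shallow or not) that precedes
the redex contracted by an earlier step `S`. -/
def Standard (ρ : List Redex) : Prop :=
  ∀ (α : List Redex) (S : Redex) (σ : List Redex) (R : Redex) (β : List Redex),
    ρ = α ++ S :: (σ ++ R :: β) →
    ∀ D : Redex, D.source = S.source → D.position.LO S.position →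
      ¬ Redex.Residual (S :: σ) D R

/-- Every step of `ρ` contracts the leftmost-outermost useful redex. -/
def LOUDerivation (ρ : List Redex) : Prop := ∀ R ∈ ρ, R.IsLOU

/-- The terms duplicated along `ρ` are subterms of `t`, up to the names of variables. -/
def SubtermProperty (t : Term) (ρ : List Redex) : Prop :=
  ∀ (D E : Ctx) (u : Term), Redex.ls D E u ∈ ρ → u.erase.Subterm t.erase

/-! ### A pointer machine with a step count

Memory consists of records (named by natural numbers) with numbered fields. Programs are finite
lists of possibly recursive procedures; they can follow, compare and store references and allocate
records, and there is no arithmetic. Every instruction costs one unit of time. -/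

/-- Commands; `call r p args` calls procedure `p` with the values of the registers `args` in its
registers `0, 1, …` and puts the value that it leaves in its register `0` into register `r`. -/
inductive Cmd : Type
  | skip : Cmd
  | const (r n : ℕ) : Cmd
  | move (r s : ℕ) : Cmd
  | load (r s f : ℕ) : Cmd
  | store (r f s : ℕ) : Cmd
  | alloc (r : ℕ) : Cmd
  | seq (c d : Cmd) : Cmd
  | ifEq (r s : ℕ) (c d : Cmd) : Cmd
  | call (r p : ℕ) (args : List ℕ) : Cmd

/-- A machine state: registers, memory (record, field), and the first record not yet in use. -/
structure State : Type where
  reg : ℕ → ℕ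
  mem : ℕ → ℕ → ℕ
  next : ℕ

/-- Write the value `v` into the register `r`. -/
def State.setReg (s : State) (r v : ℕ) : State :=
  { s with reg := Function.update s.reg r v }

/-- `Exec P c s n s'`: the command `c` of the program `P`, started in the state `s`, terminates
after `n` units of time in the state `s'`. -/
inductive Exec (P : List Cmd) : Cmd → State → ℕ → State → Prop
  | skip (s : State) : Exec P Cmd.skip s 1 s
  | const (s : State) (r n : ℕ) : Exec P (Cmd.const r n) s 1 (s.setReg r n)
  | move (s : State) (r q : ℕ) : Exec P (Cmd.move r q) s 1 (s.setReg r (s.reg q))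
  | load (s : State) (r q f : ℕ) :
      Exec P (Cmd.load r q f) s 1 (s.setReg r (s.mem (s.reg q) f))
  | store (s : State) (r f q : ℕ) :
      Exec P (Cmd.store r f q) s 1
        { s with
          mem := Function.update s.mem (s.reg r)
            (Function.update (s.mem (s.reg r)) f (s.reg q)) }
  | alloc (s : State) (r : ℕ) :
      Exec P (Cmd.alloc r) s 1 { s.setReg r s.next with next := s.next + 1 }
  | seq (s s₁ s₂ : State) (c d : Cmd) (m n : ℕ) :
      Exec P c s m s₁ → Exec P d s₁ n s₂ → Exec P (Cmd.seq c d) s (m + n) s₂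
  | ifTrue (s s₁ : State) (r q : ℕ) (c d : Cmd) (n : ℕ) :
      s.reg r = s.reg q → Exec P c s n s₁ → Exec P (Cmd.ifEq r q c d) s (n + 1) s₁
  | ifFalse (s s₁ : State) (r q : ℕ) (c d : Cmd) (n : ℕ) :
      s.reg r ≠ s.reg q → Exec P d s n s₁ → Exec P (Cmd.ifEq r q c d) s (n + 1) s₁
  | call (s s₁ : State) (r p : ℕ) (args : List ℕ) (b : Cmd) (n : ℕ) :
      P[p]? = some b →
      Exec P b { s with reg := fun i => (args.map s.reg).getD i 0 } n s₁ →
      Exec P (Cmd.call r p args) s (n + 1)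
        { s₁ with reg := Function.update s.reg r (s₁.reg 0) }

/-! ### Terms in memory

One record per constructor. Field `0` is the tag (`0` variable, `1` abstraction, `2` application,
`3` explicit substitution), fields `1` and `2` refer to the immediate subterms, field `3` to the
parent and field `4` of a variable to its binder. The other fields are free for use. -/

/-- The records of the term `t` stored at `a`, in preorder. -/
def cells (mem : ℕ → ℕ → ℕ) : ℕ → Term → List ℕ
  | a, Term.var _ => [a]
  | a, Term.lam t => a :: cells mem (mem a 1) t
  | a, Term.app t u => a :: (cells mem (mem a 1) t ++ cells mem (mem a 2) u)
  | a, Term.sub t u => a :: (cells mem (mem a 1) t ++ cells mem (mem a 2) u)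

/-- `Stored mem Γ p a t`: the term `t` is stored at `a` with parent `p`, where the index `i` is
represented by the `i`-th record of the list `Γ`. -/
def Stored (mem : ℕ → ℕ → ℕ) : List ℕ → ℕ → ℕ → Term → Prop
  | Γ, p, a, Term.var i => mem a 0 = 0 ∧ mem a 3 = p ∧ Γ[i]? = some (mem a 4)
  | Γ, p, a, Term.lam t => mem a 0 = 1 ∧ mem a 3 = p ∧ Stored mem (a :: Γ) a (mem a 1) t
  | Γ, p, a, Term.app t u => mem a 0 = 2 ∧ mem a 3 = p ∧
      Stored mem Γ a (mem a 1) t ∧ Stored mem Γ a (mem a 2) u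
  | Γ, p, a, Term.sub t u => mem a 0 = 3 ∧ mem a 3 = p ∧
      Stored mem (a :: Γ) a (mem a 1) t ∧ Stored mem Γ a (mem a 2) u

/-- The memory of `s` represents `t`: field `1` of the record `root` refers to the root of `t`, the
records in `Γ` stand for the free variables, and all records involved are distinct and in use. -/
def Represents (s : State) (root : ℕ) (Γ : List ℕ) (t : Term) : Prop :=
  Stored s.mem Γ root (s.mem root 1) t ∧
  (root :: (Γ ++ cells s.mem (s.mem root 1) t)).Nodup ∧
  ∀ x ∈ root :: (Γ ++ cells s.mem (s.mem root 1) t), x < s.next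

/-- Follow a path in memory, starting from the record `a`. -/
def follow (mem : ℕ → ℕ → ℕ) : ℕ → List Dir → ℕ
  | a, [] => a
  | a, Dir.lam :: p => follow mem (mem a 1) p
  | a, Dir.fn :: p => follow mem (mem a 1) p
  | a, Dir.arg :: p => follow mem (mem a 2) p
  | a, Dir.body :: p => follow mem (mem a 1) p
  | a, Dir.content :: p => follow mem (mem a 2) p

/-- How a redex is handed to a program: a `db` redex by references to its application and to its
abstraction, an `ls` redex by a reference to the variable occurrence. -/
def Redex.handles (mem : ℕ → ℕ → ℕ) (a : ℕ) : Redex → List ℕ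
  | Redex.db C L _ _ =>
      [follow mem a C.path,
        follow mem a (C.path ++ Dir.fn :: List.replicate L.length Dir.body)]
  | Redex.ls D E u => [follow mem a (Redex.ls D E u).position.path]

/-- The program `P` (its procedure `0`) implements the redex `R` in time at most `n`: on every
memory that represents the source of `R` it terminates within `n` units of time with a memory that
represents the target of `R`. -/
def Implements (P : List Cmd) (R : Redex) (n : ℕ) : Prop :=
  ∀ (s : State) (root : ℕ) (Γ : List ℕ), Represents s root Γ R.source →
    ∃ (m : ℕ) (s' : State), m ≤ n ∧
      Exec P (Cmd.call 0 0 [0, 1])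
        { s with reg := fun i => (R.handles s.mem (s.mem root 1)).getD i 0 } m s' ∧
      Represents s' root Γ R.target

end LSC

open LSC

/-!
Terms are compared up to `erase`, so a box subterm of a term is an element of the set `Term.boxes`,
and `Ctx.boxesAfter s K` collects those box subterms of `K⟨s⟩` that lie after the position `K` in
the left-to-right outside-in order.

The invariant is an inclusion of such sets. A step only moves the boxes to the right of its position
or copies boxes from there (`Redex.boxesAfter_after_subset`). If `R` follows `S` in a standard
derivation, then every box after `R` in the term between them is after `S`
(`Redex.boxesAfter_before_subset_of_standard`). This is clear if `R` is not to the left of `S`. If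
it is, `Redex.exists_ancestor` shows that either `R` is the residual of a redex to the left of `S`,
which standardness forbids, or `S` has created the `db` redex `R` by putting an abstraction under
the explicit substitutions on its function side, and then no box lies between the two positions.
The content duplicated by an `ls` step is a box after the position of that step, which gives the
subterm property.

LOU derivations are standard (`LOUDerivation.standard`). A redex `D` to the left of an LOU step `S`
has itself as its only residual. No step that is shallow and to the right of `D` can change the
content of an explicit substitution with `D` in its scope, so `D` is useful after the step only if
it was useful before (this is the last part of `Redex.exists_ancestor`), and then `S` was not the
LOU redex. So the residual of `D` stays strictly to the left of the following LOU steps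
(`Redex.IsLOU.residual_lo`), and it is never contracted.

The size bound is immediate, since a `db` step shrinks the term and an `ls` step adds at most the
size of what it duplicates. For the machine, a `db` step is a constant number of pointer updates
(`Represents.db`). An `ls` step copies the content, in time linear in its size and hence in the size
of the initial term. The copy has to distinguish variables bound inside the content, whose copies
refer to copied binders, from the other ones. As there is neither arithmetic nor initialized
memory, a first traversal lets a forwarding field of the binder of every variable refer to the
binder itself, and the traversal that copies overwrites this field for the binders it meets
(`runs_resetBinders`, `runs_copyTerm`).
-/

namespace LSC

/-! ### Contexts and their paths -/

namespace Ctx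

@[simp] theorem plug_comp (C D : Ctx) (t : Term) : (C.comp D).plug t = C.plug (D.plug t) := by
  induction C <;> simp_all [comp, plug]

@[simp] theorem path_comp (C D : Ctx) : (C.comp D).path = C.path ++ D.path := by
  induction C <;> simp_all [comp, path]

@[simp] theorem comp_hole (C : Ctx) : C.comp hole = C := by
  induction C <;> simp_all [comp]

theorem comp_assoc (C D E : Ctx) : (C.comp D).comp E = C.comp (D.comp E) := by
  induction C <;> simp_all [comp]

theorem plug_injective {C : Ctx} {t u : Term} (h : C.plug t = C.plug u) : t = u := by
  induction C <;> simp_all [plug]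

@[simp] theorem path_ofSubst (L : List Term) :
    (ofSubst L).path = List.replicate L.length Dir.body := by
  induction L <;> simp_all [ofSubst, path, List.replicate_succ]

theorem path_eq_nil {C : Ctx} : C.path = [] ↔ C = hole := by
  cases C <;> simp [path]

theorem shallow_iff {C : Ctx} : C.Shallow ↔ Dir.content ∉ C.path := by
  induction C <;> simp_all [Shallow, path]

theorem exists_comp_of_path_eq_append {A : Ctx} {p q : List Dir} (h : A.path = p ++ q) :
    ∃ C D : Ctx, A = C.comp D ∧ C.path = p ∧ D.path = q := by
  induction p generalizing A with
  | nil => exact ⟨hole, A, rfl, rfl, h⟩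
  | cons d p ih =>
    cases A with
    | hole => simp [path] at h
    | lam A =>
      simp only [path, List.cons_append, List.cons.injEq] at h
      obtain ⟨C, D, rfl, hC, hD⟩ := ih h.2
      exact ⟨lam C, D, rfl, by simp [path, hC, h.1], hD⟩
    | appL A r =>
      simp only [path, List.cons_append, List.cons.injEq] at h
      obtain ⟨C, D, rfl, hC, hD⟩ := ih h.2
      exact ⟨appL C r, D, rfl, by simp [path, hC, h.1], hD⟩
    | appR r A =>
      simp only [path, List.cons_append, List.cons.injEq] at h
      obtain ⟨C, D, rfl, hC, hD⟩ := ih h.2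
      exact ⟨appR r C, D, rfl, by simp [path, hC, h.1], hD⟩
    | subL A r =>
      simp only [path, List.cons_append, List.cons.injEq] at h
      obtain ⟨C, D, rfl, hC, hD⟩ := ih h.2
      exact ⟨subL C r, D, rfl, by simp [path, hC, h.1], hD⟩
    | subR r A =>
      simp only [path, List.cons_append, List.cons.injEq] at h
      obtain ⟨C, D, rfl, hC, hD⟩ := ih h.2
      exact ⟨subR r C, D, rfl, by simp [path, hC, h.1], hD⟩

/-- A prefix of a term is determined by its path, and it factors through every prefix of the same
term with a shorter path. -/
theorem eq_comp_of_path_eq_append {C D : Ctx} {t u : Term} {q : List Dir}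
    (h : C.plug t = D.plug u) (hp : D.path = C.path ++ q) :
    ∃ X : Ctx, D = C.comp X ∧ X.path = q ∧ t = X.plug u := by
  obtain ⟨C', X, rfl, hC, hX⟩ := exists_comp_of_path_eq_append hp
  suffices C = C' ∧ t = X.plug u from ⟨X, by rw [this.1], hX, this.2⟩
  rw [plug_comp] at h
  generalize X.plug u = v at h
  clear hp hX
  induction C generalizing C' with
  | hole => rw [path, path_eq_nil] at hC; subst hC; exact ⟨rfl, h⟩
  | lam C ih | appL C _ ih | appR _ C ih | subL C _ ih | subR _ C ih =>
    cases C' <;> simp only [path, reduceCtorEq, List.cons.injEq, true_and, false_and] at hC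
    simp only [plug, Term.lam.injEq, Term.app.injEq, Term.sub.injEq] at h
    have := ih _ hC (by tauto)
    exact ⟨by simp [this.1, h], this.2⟩

theorem exists_of_comp_eq_comp {A B C D : Ctx} (h : A.comp B = C.comp D) :
    (∃ X, C = A.comp X ∧ B = X.comp D) ∨ ∃ X, A = C.comp X ∧ D = X.comp B := by
  induction A generalizing C with
  | hole => exact .inl ⟨C, rfl, h⟩
  | lam A ih | appL A _ ih | appR _ A ih | subL A _ ih | subR _ A ih =>
    cases C with
    | hole => exact .inr ⟨_, rfl, h.symm⟩
    | lam C | appL C _ | appR _ C | subL C _ | subR _ C =>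
      simp only [comp, reduceCtorEq, lam.injEq, appL.injEq, appR.injEq, subL.injEq,
        subR.injEq] at h
      all_goals
        rcases ih (C := C) (by tauto) with ⟨X, h1, h2⟩ | ⟨X, h1, h2⟩
        · exact .inl ⟨X, by simp [comp, h, h1], h2⟩
        · exact .inr ⟨X, by simp [comp, h, h1], h2⟩

end Ctx

/-! ### The left-to-right outside-in order is lexicographic on paths -/

/-- The order of the two directions below an application or an explicit substitution. -/
inductive Dir.Before : Dir → Dir → Prop
  | app : Before fn arg
  | sub : Before body content

/-- The lexicographic order on paths. -/
abbrev PathLT : List Dir → List Dir → Prop := List.Lex Dir.Before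

theorem Dir.Before.trans {a b c : Dir} (h : Before a b) (h' : Before b c) : Before a c := by
  cases h <;> cases h'

theorem PathLT.irrefl {p : List Dir} : ¬ PathLT p p := by
  induction p with
  | nil => nofun
  | cons a p ih =>
    intro h
    cases h with
    | cons h => exact ih h
    | rel h => cases h

theorem PathLT.trans {p q r : List Dir} (h : PathLT p q) (h' : PathLT q r) : PathLT p r := by
  induction h generalizing r with
  | nil => cases h' <;> exact .nil
  | cons h ih =>
    cases h' with
    | cons h' => exact .cons (ih h')
    | rel h' => exact .rel h'
  | rel h =>
    cases h' with
    | cons h' => exact .rel h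
    | rel h' => exact .rel (h.trans h')

theorem PathLT.asymm {p q : List Dir} (h : PathLT p q) (h' : PathLT q p) : False :=
  irrefl (h.trans h')

theorem PathLT.append {p q : List Dir} (hq : q ≠ []) : PathLT p (p ++ q) := by
  induction p with
  | nil => cases q with
    | nil => exact absurd rfl hq
    | cons => exact .nil
  | cons a p ih => exact .cons ih

/-- A path strictly between `p` and `p ++ q`, where `q` never turns right, lies on `p ++ q`. -/
theorem PathLT.eq_append {p q b : List Dir} (hq : ∀ a ∈ q, ∀ d, ¬ Dir.Before d a)
    (h : PathLT p b) (h' : PathLT b (p ++ q)) :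
    ∃ q₁ q₂, q₁ ≠ [] ∧ q₂ ≠ [] ∧ q = q₁ ++ q₂ ∧ b = p ++ q₁ := by
  induction p generalizing b with
  | nil =>
    have hb : b ≠ [] := by rintro rfl; cases h
    clear h
    rw [List.nil_append] at h'
    suffices ∃ q₂, q₂ ≠ [] ∧ q = b ++ q₂ by
      obtain ⟨q₂, h₂, h⟩ := this
      exact ⟨b, q₂, hb, h₂, h, rfl⟩
    clear hb
    induction b generalizing q with
    | nil =>
      refine ⟨q, ?_, rfl⟩
      rintro rfl
      cases h'
    | cons a b ih =>
      cases h' with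
      | cons h' =>
        obtain ⟨q₂, h₂, rfl⟩ := ih (fun a ha => hq a (List.mem_cons_of_mem _ ha)) h'
        exact ⟨q₂, h₂, rfl⟩
      | rel h' => exact absurd h' (hq _ List.mem_cons_self _)
  | cons a p ih =>
    cases h with
    | cons h =>
      cases h' with
      | cons h' =>
        obtain ⟨q₁, q₂, h₁, h₂, h₃, rfl⟩ := ih h h'
        exact ⟨q₁, q₂, h₁, h₂, h₃, rfl⟩
      | rel h' => cases h'
    | rel h =>
      cases h' with
      | cons h' => cases h
      | rel h' => cases h <;> cases h'

namespace Ctx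

theorem OutsideIn.exists_comp {C D : Ctx} (h : OutsideIn C D) :
    ∃ X, X ≠ hole ∧ D = C.comp X := by
  induction h with
  | root C h => exact ⟨C, h, rfl⟩
  | closure E C D _ ih =>
    obtain ⟨X, hX, rfl⟩ := ih
    exact ⟨X, hX, (comp_assoc _ _ _).symm⟩

theorem LeftOf.exists_comp {C D : Ctx} (h : LeftOf C D) :
    ∃ (E C' D' : Ctx) (t u : Term), C'.PrefixOf t ∧ D'.PrefixOf u ∧
      ((C = E.comp (appL C' u) ∧ D = E.comp (appR t D')) ∨
        (C = E.comp (subL C' u) ∧ D = E.comp (subR t D'))) := by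
  induction h with
  | app C D t u h h' => exact ⟨hole, C, D, t, u, h, h', .inl ⟨rfl, rfl⟩⟩
  | sub C D t u h h' => exact ⟨hole, C, D, t, u, h, h', .inr ⟨rfl, rfl⟩⟩
  | closure F C D _ ih =>
    obtain ⟨E, C', D', t, u, h, h', ⟨rfl, rfl⟩ | ⟨rfl, rfl⟩⟩ := ih
    · exact ⟨F.comp E, C', D', t, u, h, h', .inl ⟨by simp [comp_assoc], by simp [comp_assoc]⟩⟩
    · exact ⟨F.comp E, C', D', t, u, h, h', .inr ⟨by simp [comp_assoc], by simp [comp_assoc]⟩⟩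

theorem LO.comp {C D : Ctx} (E : Ctx) (h : C.LO D) : (E.comp C).LO (E.comp D) :=
  h.imp (.closure E C D) (.closure E C D)

theorem LO.pathLT {C D : Ctx} (h : C.LO D) : PathLT C.path D.path := by
  rcases h with h | h
  · obtain ⟨X, hX, rfl⟩ := h.exists_comp
    rw [path_comp]
    exact .append (path_eq_nil.not.2 hX)
  · obtain ⟨E, C', D', t, u, -, -, ⟨rfl, rfl⟩ | ⟨rfl, rfl⟩⟩ := h.exists_comp <;>
      simp only [path_comp, path] <;> apply List.Lex.append_left
    · exact .rel .app
    · exact .rel .sub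

/-- The order is total on the prefixes of a term. -/
theorem LO.trichotomy {C D : Ctx} {t u : Term} (h : C.plug t = D.plug u) :
    C.LO D ∨ C = D ∨ D.LO C := by
  induction C generalizing D with
  | hole =>
    by_cases hD : D = hole
    · exact .inr (.inl hD.symm)
    · exact .inl (.inl (.root _ hD))
  | lam C ih =>
    cases D <;> simp only [plug, reduceCtorEq, Term.lam.injEq] at h
    case hole => exact .inr (.inr (.inl (.root _ nofun)))
    case lam D =>
      rcases ih h with h | rfl | h
      · exact .inl (h.comp (lam hole))
      · exact .inr (.inl rfl)
      · exact .inr (.inr (h.comp (lam hole)))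
  | appL C r ih =>
    cases D <;> simp only [plug, reduceCtorEq, Term.app.injEq] at h
    case hole => exact .inr (.inr (.inl (.root _ nofun)))
    case appL D r' =>
      obtain ⟨h, rfl⟩ := h
      rcases ih h with h | rfl | h
      · exact .inl (h.comp (appL hole r))
      · exact .inr (.inl rfl)
      · exact .inr (.inr (h.comp (appL hole r)))
    case appR r' D =>
      obtain ⟨rfl, rfl⟩ := h
      exact .inl (.inr (.app _ _ _ _ ⟨_, rfl⟩ ⟨_, rfl⟩))
  | appR r C ih =>
    cases D <;> simp only [plug, reduceCtorEq, Term.app.injEq] at h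
    case hole => exact .inr (.inr (.inl (.root _ nofun)))
    case appR r' D =>
      obtain ⟨rfl, h⟩ := h
      rcases ih h with h | rfl | h
      · exact .inl (h.comp (appR r hole))
      · exact .inr (.inl rfl)
      · exact .inr (.inr (h.comp (appR r hole)))
    case appL D r' =>
      obtain ⟨rfl, rfl⟩ := h
      exact .inr (.inr (.inr (.app _ _ _ _ ⟨_, rfl⟩ ⟨_, rfl⟩)))
  | subL C r ih =>
    cases D <;> simp only [plug, reduceCtorEq, Term.sub.injEq] at h
    case hole => exact .inr (.inr (.inl (.root _ nofun)))
    case subL D r' =>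
      obtain ⟨h, rfl⟩ := h
      rcases ih h with h | rfl | h
      · exact .inl (h.comp (subL hole r))
      · exact .inr (.inl rfl)
      · exact .inr (.inr (h.comp (subL hole r)))
    case subR r' D =>
      obtain ⟨rfl, rfl⟩ := h
      exact .inl (.inr (.sub _ _ _ _ ⟨_, rfl⟩ ⟨_, rfl⟩))
  | subR r C ih =>
    cases D <;> simp only [plug, reduceCtorEq, Term.sub.injEq] at h
    case hole => exact .inr (.inr (.inl (.root _ nofun)))
    case subR r' D =>
      obtain ⟨rfl, h⟩ := h
      rcases ih h with h | rfl | h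
      · exact .inl (h.comp (subR r hole))
      · exact .inr (.inl rfl)
      · exact .inr (.inr (h.comp (subR r hole)))
    case subL D r' =>
      obtain ⟨rfl, rfl⟩ := h
      exact .inr (.inr (.inr (.sub _ _ _ _ ⟨_, rfl⟩ ⟨_, rfl⟩)))

theorem lo_of_pathLT {C D : Ctx} {t u : Term} (h : C.plug t = D.plug u)
    (hp : PathLT C.path D.path) : C.LO D := by
  rcases LO.trichotomy h with h | rfl | h
  · exact h
  · exact (hp.irrefl).elim
  · exact (hp.asymm h.pathLT).elim

/-! ### What usefulness depends on -/

theorem relUnfolding_comp_appL (w r r' : Term) (E C : Ctx) :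
    relUnfolding w (E.comp (appL C r)) = relUnfolding w (E.comp (appL C r')) := by
  have lams_eq (E : Ctx) : lams (E.comp (appL C r)) = lams (E.comp (appL C r')) := by
    induction E <;> simp_all [comp, lams]
  induction E <;> simp_all [comp, relUnfolding]

theorem exists_eq_ofSubst {D : Ctx} {n : ℕ} (h : D.path = List.replicate n Dir.body) :
    ∃ L, D = ofSubst L := by
  induction n generalizing D with
  | zero => exact ⟨[], path_eq_nil.1 h⟩
  | succ n ih =>
    cases D <;> simp only [path, reduceCtorEq, List.replicate_succ, List.cons.injEq, true_and,
      false_and] at h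
    obtain ⟨L, rfl⟩ := ih h
    exact ⟨_ :: L, rfl⟩

theorem applicative_iff {A : Ctx} : A.Applicative ↔
    ∃ (p : List Dir) (n : ℕ), Dir.content ∉ p ∧
      A.path = p ++ Dir.fn :: List.replicate n Dir.body := by
  constructor
  · rintro ⟨C, L, t, hC, rfl⟩
    exact ⟨C.path, L.length, shallow_iff.1 hC, by simp [path]⟩
  · rintro ⟨p, n, hp, h⟩
    obtain ⟨C, D, rfl, hC, hD⟩ := exists_comp_of_path_eq_append h
    cases D <;> simp only [path, reduceCtorEq, List.cons.injEq, true_and, false_and] at hD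
    rename_i D r
    obtain ⟨L, rfl⟩ := exists_eq_ofSubst hD
    exact ⟨C, L, r, shallow_iff.2 (hC ▸ hp), rfl⟩

theorem applicative_congr {A A' : Ctx} (h : A.path = A'.path) : A.Applicative ↔ A'.Applicative := by
  rw [applicative_iff, applicative_iff, h]

end Ctx

/-! ### Redexes -/

namespace Redex
open Ctx

/-- The term in the hole of the position of a redex. -/
def before : Redex → Term
  | db _ L r p => Term.app ((ofSubst L).plug (Term.lam r)) p
  | ls _ E _ => Term.var E.depth

/-- The term by which a step replaces the term in the hole of its position. -/
def after : Redex → Term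
  | db _ L r p => (ofSubst L).plug (Term.sub r (p.shift L.length))
  | ls _ E u => u.shift (E.depth + 1)

theorem source_eq (R : Redex) : R.source = R.position.plug R.before := by
  cases R <;> simp [source, position, before, plug]

theorem target_eq (R : Redex) : R.target = R.position.plug R.after := by
  cases R <;> simp [target, position, after, plug]

theorem ofSubst_plug_lam_eq {L M : List Term} {r v : Term}
    (h : (ofSubst L).plug (Term.lam r) = (ofSubst M).plug v) :
    ∃ N s, v = (ofSubst N).plug (Term.lam s) := by
  induction M generalizing L with
  | nil => exact ⟨L, r, h.symm⟩
  | cons m M ih =>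
    cases L with
    | nil => simp [ofSubst, plug] at h
    | cons l L =>
      simp only [ofSubst, plug, Term.sub.injEq] at h
      exact ih h.1

theorem before_ne_ofSubst_plug_lam (R : Redex) (L : List Term) (r : Term) :
    R.before ≠ (ofSubst L).plug (Term.lam r) := by
  cases R <;> cases L <;> simp [before, ofSubst, plug]

/-- A shallow position in `L⟨λ.r⟩` either lies on the spine of `L`, or the term keeps its form
whatever is put there. -/
theorem ofSubst_plug_lam_of_plug {X : Ctx} {L : List Term} {r s : Term} (hX : X.Shallow)
    (h : X.plug s = (ofSubst L).plug (Term.lam r)) :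
    (∃ M, X = ofSubst M) ∨ ∀ s', ∃ M q, X.plug s' = (ofSubst M).plug (Term.lam q) := by
  induction X generalizing L with
  | hole => exact .inl ⟨[], rfl⟩
  | lam X ih => exact .inr fun s' => ⟨[], _, rfl⟩
  | appL X _ _ | appR _ X _ => cases L <;> simp [plug, ofSubst] at h
  | subL X p ih =>
    cases L with
    | nil => simp [plug, ofSubst] at h
    | cons l L =>
      simp only [plug, ofSubst, Term.sub.injEq] at h
      rcases ih hX h.1 with ⟨M, rfl⟩ | h'
      · exact .inl ⟨p :: M, rfl⟩
      · refine .inr fun s' => ?_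
        obtain ⟨M, q, hM⟩ := h' s'
        exact ⟨p :: M, q, by simp [plug, ofSubst, hM]⟩
  | subR _ X _ => exact hX.elim

/-- A redex that precedes the position of the last step was there before that step, and it was
useful if it is useful now, unless it is a `db` redex whose abstraction has just appeared. -/
theorem exists_ancestor {S R : Redex} (hS : S.Shallow) (h : R.source = S.target)
    (hlt : R.position.LO S.position) :
    (∃ D : Redex, D.source = S.source ∧ D.position.path = R.position.path ∧
      D.position.LO S.position ∧ (R.Useful → D.Useful)) ∨
    ∃ L q, S.position = R.position.comp (appL (ofSubst L) q) := by
  rw [source_eq, target_eq] at h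
  rw [source_eq S]
  unfold Redex.Shallow at hS
  generalize S.position = K at *
  generalize S.before = s, S.after = s' at *
  rcases hlt with hlt | hlt
  · -- The step takes place inside `R`.
    obtain ⟨X, hX, rfl⟩ := hlt.exists_comp
    rw [plug_comp] at h
    replace h := plug_injective h
    cases R with
    | ls D E u => cases X <;> simp [before, plug] at h hX
    | db C L r p =>
      simp only [before, position] at *
      cases X <;> simp only [plug, reduceCtorEq, Term.app.injEq] at h
      case hole => exact absurd rfl hX
      case appL X q =>
        have hX' : X.Shallow := by
          rw [shallow_iff] at hS ⊢
          intro hc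
          exact hS (by simp [path, hc])
        rcases ofSubst_plug_lam_of_plug hX' h.1.symm with ⟨M, rfl⟩ | hM
        · exact .inr ⟨M, q, rfl⟩
        · obtain ⟨M, r', hM⟩ := hM s
          refine .inl ⟨db C M r' q, ?_, rfl, .inl hlt, fun _ => trivial⟩
          simp [source, plug, hM]
      case appR q X =>
        refine .inl ⟨db C L r (X.plug s), ?_, rfl, .inl hlt, fun _ => trivial⟩
        simp [source, plug, h.1]
  · -- The step takes place to the right of `R`, so that no explicit substitution with `R` in its
    -- scope has changed its content.
    obtain ⟨F, C', D', t, u, ⟨t', rfl⟩, ⟨u', rfl⟩, ⟨hR, rfl⟩ | ⟨hR, rfl⟩⟩ := hlt.exists_comp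
    swap
    · rw [shallow_iff] at hS
      simp [path] at hS
    simp only [hR, plug_comp] at h
    replace h := plug_injective h
    simp only [plug, Term.app.injEq] at h
    have ht := plug_injective h.1
    subst ht
    left
    set v := D'.plug s with hv
    have hlo : (F.comp (appL C' v)).LO (F.comp (appR (C'.plug R.before) D')) :=
      .inr (.closure _ _ _ (.app _ _ _ _ ⟨_, rfl⟩ ⟨_, rfl⟩))
    cases R with
    | db C L r p =>
      refine ⟨db (F.comp (appL C' v)) L r p, ?_, ?_, hlo, id⟩
      · simp [source, plug, before, hv]
      · simp only [position] at hR ⊢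
        simp [hR, path]
    | ls D E w =>
      simp only [position] at hR ⊢
      obtain ⟨D₁, E₁, hpos, hdep⟩ : ∃ D₁ E₁ : Ctx, D₁.comp (subL E₁ w) = F.comp (appL C' v) ∧
          E₁.depth = E.depth := by
        rcases exists_of_comp_eq_comp hR with ⟨X, rfl, hX⟩ | ⟨X, rfl, hX⟩
        · cases X <;> simp only [comp, reduceCtorEq, subL.injEq] at hX
          rename_i X _
          obtain ⟨rfl, rfl⟩ := hX
          refine ⟨D, X.comp (appL C' v), by simp [comp, comp_assoc], ?_⟩
          clear hR h hS hlt hlo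
          induction X <;> simp_all [comp, depth]
        · cases X <;> simp only [comp, reduceCtorEq, appL.injEq] at hX
          rename_i X _
          obtain ⟨rfl, rfl⟩ := hX
          exact ⟨F.comp (appL X v), E, by simp [comp, comp_assoc], rfl⟩
      refine ⟨ls D₁ E₁ w, ?_, ?_, ?_, ?_⟩
      · have : (ls D₁ E₁ w).source = (D₁.comp (subL E₁ w)).plug (Term.var E.depth) := by
          simp [source, plug, hdep]
        rw [this, hpos]
        simp [plug, before, hv]
      · simp only
        rw [hpos, hR]
        simp [path]
      · simpa only [hpos] using hlo
      · simp only [Useful]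
        rw [hpos, hR, hdep, relUnfolding_comp_appL _ _ v,
          applicative_congr (A := F.comp (appL C' v)) (A' := F.comp (appL C' (D'.plug u')))
            (by simp [path])]
        exact id

end Redex

open Ctx

/-! ### Box subterms to the right of a position -/

namespace Term

/-- The box subterms of a term, up to the names of variables. -/
def boxes : Term → Set Term
  | var _ => ∅
  | lam t => boxes t
  | app t u => insert u.erase (boxes t ∪ boxes u)
  | sub t u => insert u.erase (boxes t ∪ boxes u)

theorem erase_shiftFrom (d c : ℕ) (t : Term) : (shiftFrom d c t).erase = t.erase := by
  induction t generalizing c with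
  | var i => simp only [shiftFrom]; split <;> rfl
  | lam t ih => simp [shiftFrom, erase, ih]
  | app t u iht ihu | sub t u iht ihu => simp [shiftFrom, erase, iht, ihu]

@[simp] theorem erase_shift (d : ℕ) (t : Term) : (t.shift d).erase = t.erase :=
  erase_shiftFrom d 0 t

@[simp] theorem boxes_shift (d : ℕ) (t : Term) : (t.shift d).boxes = t.boxes := by
  suffices ∀ c, (shiftFrom d c t).boxes = t.boxes from this 0
  induction t with
  | var i => intro c; simp only [shiftFrom]; split <;> rfl
  | lam t ih => simp [shiftFrom, boxes, ih]
  | app t u iht ihu | sub t u iht ihu => simp [shiftFrom, boxes, erase_shiftFrom, iht, ihu]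

@[simp] theorem size_erase (t : Term) : t.erase.size = t.size := by
  induction t <;> simp_all [erase, size]

theorem boxSubterm_of_mem_boxes {w t : Term} (h : w ∈ t.boxes) : w.BoxSubterm t.erase := by
  have lift {w t : Term} (E : Ctx) (h : w.BoxSubterm t) : w.BoxSubterm (E.plug t) := by
    obtain ⟨B, hB, rfl⟩ := h
    exact ⟨E.comp B, .closure _ _ hB, plug_comp _ _ _⟩
  induction t with
  | var i => exact h.elim
  | lam t ih => exact lift (Ctx.lam hole) (ih h)
  | app t u iht ihu =>
    rcases h with rfl | h | h
    · exact ⟨_, .arg t.erase, rfl⟩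
    · exact lift (appL hole u.erase) (iht h)
    · exact lift (appR t.erase hole) (ihu h)
  | sub t u iht ihu =>
    rcases h with rfl | h | h
    · exact ⟨_, .content t.erase, rfl⟩
    · exact lift (subL hole u.erase) (iht h)
    · exact lift (subR t.erase hole) (ihu h)

theorem BoxSubterm.subterm {u t : Term} (h : u.BoxSubterm t) : u.Subterm t := by
  obtain ⟨B, -, h⟩ := h
  exact ⟨B, h⟩

end Term

namespace Ctx

theorem boxes_subset_boxes_plug (C : Ctx) (t : Term) : t.boxes ⊆ (C.plug t).boxes := by
  induction C with
  | hole => exact subset_rfl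
  | lam C ih => exact ih
  | appL C u ih | subL C u ih => exact fun x hx => .inr (.inl (ih hx))
  | appR u C ih | subR u C ih => exact fun x hx => .inr (.inr (ih hx))

/-- Being a box context is a property of the last step of the path. -/
theorem IsBox.getLast_path {B : Ctx} (h : B.IsBox) :
    B.path.getLast? = some Dir.arg ∨ B.path.getLast? = some Dir.content := by
  induction h with
  | arg => exact .inl rfl
  | content => exact .inr rfl
  | closure C B _ ih =>
    rw [path_comp, List.getLast?_append]
    exact ih.imp (fun h => by rw [h]; rfl) fun h => by rw [h]; rfl

theorem erase_mem_boxes_plug {B : Ctx}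
    (h : B.path.getLast? = some Dir.arg ∨ B.path.getLast? = some Dir.content) (v : Term) :
    v.erase ∈ (B.plug v).boxes := by
  obtain ⟨d, hd, h⟩ : ∃ d, (d = Dir.arg ∨ d = Dir.content) ∧ B.path.getLast? = some d :=
    h.elim (fun h => ⟨_, .inl rfl, h⟩) fun h => ⟨_, .inr rfl, h⟩
  obtain ⟨p, hp⟩ := List.getLast?_eq_some_iff.1 h
  obtain ⟨C, D, rfl, -, hD⟩ := exists_comp_of_path_eq_append hp
  rw [plug_comp]
  apply boxes_subset_boxes_plug
  cases D <;> simp only [path, reduceCtorEq, List.cons.injEq, path_eq_nil] at hD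
  case appR | subR => obtain ⟨-, rfl⟩ := hD; exact .inl rfl
  all_goals rcases hd with rfl | rfl <;> simp at hD

/-- The box subterms of `K⟨s⟩` that come after the position `K`, up to the names of variables. -/
def boxesAfter (s : Term) : Ctx → Set Term
  | hole => s.boxes
  | lam C => boxesAfter s C
  | appL C u => insert u.erase (boxesAfter s C ∪ u.boxes)
  | appR _ C => boxesAfter s C
  | subL C u => insert u.erase (boxesAfter s C ∪ u.boxes)
  | subR _ C => boxesAfter s C

theorem boxesAfter_subset_boxes (s : Term) (K : Ctx) : boxesAfter s K ⊆ (K.plug s).boxes := by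
  induction K with
  | hole => exact subset_rfl
  | lam C ih => exact ih
  | appL C u ih | subL C u ih => exact Set.insert_subset_insert (Set.union_subset_union_left _ ih)
  | appR u C ih | subR u C ih => exact fun x hx => .inr (.inr (ih hx))

theorem boxes_subset_boxesAfter (s : Term) (K : Ctx) : s.boxes ⊆ boxesAfter s K := by
  induction K with
  | hole => exact subset_rfl
  | lam C ih | appR _ C ih | subR _ C ih => exact ih
  | appL C u ih | subL C u ih => exact fun x hx => .inr (.inl (ih hx))

theorem boxesAfter_comp_subset {s s' : Term} {X Y : Ctx} (K : Ctx)
    (h : boxesAfter s X ⊆ boxesAfter s' Y) :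
    boxesAfter s (K.comp X) ⊆ boxesAfter s' (K.comp Y) := by
  induction K with
  | hole => exact h
  | lam C ih | appR _ C ih | subR _ C ih => exact ih
  | appL C u ih | subL C u ih => exact Set.insert_subset_insert (Set.union_subset_union_left _ ih)

theorem boxesAfter_mono {s s' : Term} (K : Ctx) (h : s.boxes ⊆ s'.boxes) :
    boxesAfter s K ⊆ boxesAfter s' K := by
  simpa using boxesAfter_comp_subset (X := hole) (Y := hole) K h

theorem boxesAfter_subset_comp (s : Term) (K X : Ctx) :
    boxesAfter s X ⊆ boxesAfter s (K.comp X) := by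
  induction K with
  | hole => exact subset_rfl
  | lam C ih | appR _ C ih | subR _ C ih => exact ih
  | appL C u ih | subL C u ih => exact fun x hx => .inr (.inl (ih hx))

theorem boxesAfter_subset_union (s s' : Term) (K : Ctx) :
    boxesAfter s' K ⊆ boxesAfter s K ∪ s'.boxes := by
  induction K with
  | hole => exact Set.subset_union_right
  | lam C ih | appR _ C ih | subR _ C ih => exact ih
  | appL C u ih | subL C u ih =>
    rintro x (hx | hx | hx)
    · exact .inl (.inl hx)
    · exact (ih hx).imp (fun h => .inr (.inl h)) id
    · exact .inl (.inr (.inr hx))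

theorem erase_mem_boxesAfter {K B : Ctx} {s v : Term} (h : K.plug s = B.plug v) (hB : B.IsBox)
    (hlt : K.LO B) : v.erase ∈ boxesAfter s K := by
  have hB := hB.getLast_path
  rcases hlt with hlt | hlt
  · obtain ⟨X, hX, rfl⟩ := hlt.exists_comp
    rw [plug_comp] at h
    rw [plug_injective h]
    apply boxes_subset_boxesAfter
    rw [path_comp, List.getLast?_append_of_ne_nil _ (path_eq_nil.not.2 hX)] at hB
    exact erase_mem_boxes_plug hB v
  · obtain ⟨E, C, D, t, u, -, ⟨u', rfl⟩, ⟨rfl, rfl⟩ | ⟨rfl, rfl⟩⟩ := hlt.exists_comp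
    all_goals
      rw [plug_comp, plug_comp] at h
      have h := plug_injective h
      simp only [plug, Term.app.injEq, Term.sub.injEq] at h
      obtain rfl := plug_injective h.2
      apply boxesAfter_subset_comp
      rw [path_comp, path, ← List.singleton_append, ← List.append_assoc] at hB
      by_cases hD : D = hole
      · subst hD
        exact .inl rfl
      · rw [List.getLast?_append_of_ne_nil _ (path_eq_nil.not.2 hD)] at hB
        exact .inr (.inr (erase_mem_boxes_plug hB u'))

/-- Moving the position to the right within a term loses box subterms only. -/
theorem boxesAfter_subset_of_lo {K K' : Ctx} {s s' : Term} (h : K.plug s = K'.plug s')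
    (hlt : K.LO K') : boxesAfter s' K' ⊆ boxesAfter s K := by
  rcases hlt with hlt | hlt
  · obtain ⟨X, -, rfl⟩ := hlt.exists_comp
    rw [plug_comp] at h
    rw [plug_injective h]
    simpa using boxesAfter_comp_subset (s' := X.plug s') (Y := hole) K
      (boxesAfter_subset_boxes s' X)
  · obtain ⟨E, C, D, t, u, -, ⟨u', rfl⟩, ⟨rfl, rfl⟩ | ⟨rfl, rfl⟩⟩ := hlt.exists_comp
    all_goals
      rw [plug_comp, plug_comp] at h
      have h := plug_injective h
      simp only [plug, Term.app.injEq, Term.sub.injEq] at h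
      rw [plug_injective h.2]
      apply boxesAfter_comp_subset
      exact fun x hx => .inr (.inr (boxesAfter_subset_boxes _ _ hx))

end Ctx

/-! ### The invariant of standard derivations -/

namespace Redex

theorem boxes_ofSubst_plug_sub_subset (L : List Term) (r p : Term) :
    ((ofSubst L).plug (Term.sub r p)).boxes ⊆
      insert p.erase (((ofSubst L).plug (Term.lam r)).boxes ∪ p.boxes) := by
  induction L with
  | nil => exact subset_rfl
  | cons l L ih =>
    rintro x (hx | hx | hx)
    · exact .inr (.inl (.inl hx))
    · exact (ih hx).imp id fun h => h.imp (fun h => .inr (.inl h)) id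
    · exact .inr (.inl (.inr (.inr hx)))

/-- A step creates no box subterm to the right of its position. -/
theorem boxesAfter_after_subset (R : Redex) :
    boxesAfter R.after R.position ⊆ boxesAfter R.before R.position := by
  cases R with
  | db C L r p =>
    apply boxesAfter_mono
    simpa [after, before, Term.boxes] using
      boxes_ofSubst_plug_sub_subset L r (p.shift L.length)
  | ls D E u =>
    apply boxesAfter_comp_subset
    rintro x (hx | hx | hx)
    · exact .inl hx
    · refine .inr ((boxesAfter_subset_union (ls D E u).before _ E hx).imp id fun h => ?_)
      simpa [after] using h
    · exact .inr (.inr hx)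

theorem erase_mem_boxesAfter_ls (D E : Ctx) (u : Term) :
    u.erase ∈ boxesAfter (ls D E u).before (ls D E u).position :=
  boxesAfter_subset_comp _ D _ (.inl rfl)

/-- If `R` follows `S` in a standard derivation, then all that is to the right of `R` is to the
right of `S`. -/
theorem boxesAfter_before_subset_of_standard {S R : Redex} (hS : S.Shallow)
    (h : R.source = S.target)
    (hst : ∀ D : Redex, D.source = S.source → D.position.LO S.position → ¬ Residual [S] D R) :
    boxesAfter R.before R.position ⊆ boxesAfter S.after S.position := by
  have h' := h
  rw [source_eq, target_eq] at h'
  rcases LO.trichotomy h' with hlt | heq | hlt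
  · rcases exists_ancestor hS h hlt with ⟨D, hD, hp, hlo, -⟩ | ⟨L, q, hpos⟩
    · refine absurd ⟨R, hD, h, ?_, rfl⟩ (hst D hD hlo)
      rw [hp]
      refine .outside _ _ fun hpre => ?_
      rw [← hp] at hpre
      obtain ⟨q, hq⟩ := hpre
      have hlt := hlo.pathLT
      rw [← hq] at hlt
      by_cases hq' : q = []
      · simp [hq'] at hlt
        exact hlt.irrefl
      · exact hlt.asymm (.append hq')
    · -- `R` has just been created by `S`: nothing but the spine `L` is between them.
      rw [hpos, plug_comp] at h'
      rw [plug_injective h', hpos]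
      have hspine : ∀ M : List Term, ((ofSubst M).plug S.after).boxes ⊆
          boxesAfter S.after (ofSubst M) := by
        intro M
        induction M with
        | nil => exact subset_rfl
        | cons m M ih => exact Set.insert_subset_insert (Set.union_subset_union_left _ ih)
      simpa using boxesAfter_comp_subset (X := hole) (Y := appL (ofSubst L) q) R.position
        (Set.insert_subset_insert (Set.union_subset_union_left _ (hspine L)))
  · rw [heq] at h' ⊢
    rw [plug_injective h']
  · exact boxesAfter_subset_of_lo h'.symm hlt

end Redex

theorem IsDerivation.append_inv {t u : Term} {α β : List Redex} (h : IsDerivation t (α ++ β) u) :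
    ∃ m, IsDerivation t α m ∧ IsDerivation m β u := by
  induction α generalizing t with
  | nil => exact ⟨t, .nil t, h⟩
  | cons R α ih =>
    cases h with
    | cons _ _ _ _ hs he h =>
      obtain ⟨m, h₁, h₂⟩ := ih h
      exact ⟨m, .cons _ _ _ _ hs he h₁, h₂⟩

theorem IsDerivation.snoc_inv {t u : Term} {ρ : List Redex} {R : Redex}
    (h : IsDerivation t (ρ ++ [R]) u) :
    IsDerivation t ρ R.source ∧ R.Shallow ∧ R.target = u := by
  obtain ⟨m, h₁, h₂⟩ := h.append_inv
  cases h₂ with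
  | cons _ _ _ _ hs he h =>
    cases h
    exact ⟨he ▸ h₁, hs, rfl⟩

theorem Standard.of_append {ρ σ : List Redex} (h : Standard (ρ ++ σ)) : Standard ρ :=
  fun α S τ R β hρ => h α S τ R (β ++ σ) (by simp [hρ])

/-- The invariant, stated before the last step. -/
theorem Standard.boxesAfter_subset {t u : Term} {ρ : List Redex} {R : Redex}
    (h : IsDerivation t (ρ ++ [R]) u) (hst : Standard (ρ ++ [R])) :
    boxesAfter R.before R.position ⊆ t.boxes := by
  induction ρ using List.reverseRecOn generalizing R u with
  | nil =>
    cases h with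
    | cons _ _ _ _ _ he _ =>
      rw [← he, R.source_eq]
      exact boxesAfter_subset_boxes _ _
  | append_singleton ρ S ih =>
    have h₁ := h.snoc_inv.1
    obtain ⟨-, hS, hSR⟩ := h₁.snoc_inv
    refine (Redex.boxesAfter_before_subset_of_standard hS hSR.symm ?_).trans
      ((Redex.boxesAfter_after_subset S).trans (ih h₁ hst.of_append))
    exact fun D => hst ρ S [] R [] (by simp) D

theorem Standard.subtermProperty {t u : Term} {ρ : List Redex} (h : IsDerivation t ρ u)
    (hst : Standard ρ) : SubtermProperty t ρ := by
  intro D E v hmem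
  obtain ⟨α, β, rfl⟩ := List.append_of_mem hmem
  rw [← List.singleton_append, ← List.append_assoc] at h hst
  obtain ⟨m, h, -⟩ := h.append_inv
  exact (Term.boxSubterm_of_mem_boxes (boxesAfter_subset h hst.of_append
    (Redex.erase_mem_boxesAfter_ls D E v))).subterm

/-! ### Leftmost-outermost useful derivations are standard -/

namespace Redex

/-- A redex to the left of a step has no residual but itself. -/
theorem Origin.path_eq {S : Redex} {C : Ctx} {q : List Dir} (h : Origin S C.path q)
    (hlt : PathLT C.path S.position.path) : q = C.path := by
  generalize C.path = p at *
  cases h with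
  | outside => rfl
  | dbSubst C L r p q => exact (hlt.asymm (.append nofun)).elim
  | dbBody C L r p q => exact (hlt.asymm (.append nofun)).elim
  | dbArg C L r p q => exact (hlt.asymm (.append nofun)).elim
  | lsCopy D E u q =>
    refine (hlt.asymm ?_).elim
    simp only [position, path_comp, path]
    exact List.Lex.append_left _ (.rel .sub) _

/-- The positions strictly between a `db` redex and a step that has created it are explicit
substitutions, not redexes. -/
theorem not_between {R D S : Redex} {L : List Term} {q : Term}
    (hpos : S.position = R.position.comp (appL (ofSubst L) q)) (hD : D.source = S.target)
    (h₁ : PathLT R.position.path D.position.path) :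
    ¬ PathLT D.position.path S.position.path := by
  intro h₂
  rw [hpos, path_comp] at h₂
  obtain ⟨q₁, q₂, hq₁, hq₂, hq, hDp⟩ := h₁.eq_append (by
    intro a ha d hd
    simp only [path, path_ofSubst, List.mem_cons, List.mem_replicate] at ha
    rcases ha with rfl | ⟨-, rfl⟩ <;> cases hd) h₂
  rw [source_eq, target_eq] at hD
  obtain ⟨X, -, hX, hb⟩ := eq_comp_of_path_eq_append (q := q₂) hD (by simp [hpos, hDp, hq])
  have hbody : ∀ d ∈ q₂, d = Dir.body := by
    intro d hd
    cases q₁ with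
    | nil => exact absurd rfl hq₁
    | cons a q₁ =>
      simp only [path, path_ofSubst, List.cons_append, List.cons.injEq] at hq
      exact List.eq_of_mem_replicate (hq.2 ▸ List.mem_append_right _ hd)
  cases q₂ with
  | nil => exact hq₂ rfl
  | cons a q₂ =>
    obtain rfl := hbody a List.mem_cons_self
    cases X <;> simp [path] at hX
    cases D <;> simp [before, plug] at hb

/-- A redex that a step to its inside creates was not a redex before. -/
theorem not_created {R D S : Redex} {L : List Term} {q : Term}
    (hpos : S.position = R.position.comp (appL (ofSubst L) q)) (hD : D.source = S.source) :
    D.position.path ≠ R.position.path := by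
  intro hp
  rw [source_eq, source_eq S] at hD
  obtain ⟨X, -, hX, hb⟩ := eq_comp_of_path_eq_append (q := (appL (ofSubst L) q).path) hD
    (by simp [hpos, hp])
  cases X <;> simp only [path, reduceCtorEq, List.cons.injEq, true_and, false_and] at hX
  rename_i X q'
  cases D with
  | ls => simp [before, plug] at hb
  | db C M r p =>
    simp only [before, plug, Term.app.injEq] at hb
    obtain ⟨N, rfl⟩ := exists_eq_ofSubst (hX.trans (path_ofSubst L))
    obtain ⟨N, s, hs⟩ := ofSubst_plug_lam_eq hb.1
    exact before_ne_ofSubst_plug_lam _ _ _ hs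

/-- Consecutive LOU steps only go to the left by contracting a redex that was just created. -/
theorem IsLOU.created {S T : Redex} (hS : S.IsLOU) (hT : T.IsLOU) (h : T.source = S.target)
    (hlt : T.position.LO S.position) :
    ∃ L q, S.position = T.position.comp (appL (ofSubst L) q) := by
  rcases exists_ancestor hS.1 h hlt with ⟨D, hD, hp, hlo, huse⟩ | h
  · have hsh : D.Shallow := by
      have := hT.1
      unfold Redex.Shallow at *
      rw [shallow_iff] at *
      rwa [hp]
    have hne : D ≠ S := by
      rintro rfl
      exact hlo.pathLT.irrefl
    exact (hlo.pathLT.asymm (hS.2.2 D hsh hD (huse hT.2.1) hne).pathLT).elim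
  · exact h

/-- The residual of a redex to the left of an LOU step is to the left of the next LOU step. -/
theorem IsLOU.residual_lo {S T D D₁ : Redex} (hS : S.IsLOU) (hT : T.IsLOU)
    (h : T.source = S.target) (hD : D.source = S.source) (hlt : D.position.LO S.position)
    (hD₁ : D₁.source = S.target) (ho : Origin S D.position.path D₁.position.path) :
    D₁.position.LO T.position := by
  have hp := ho.path_eq hlt.pathLT
  have hlt₁ : PathLT D₁.position.path S.position.path := hp ▸ hlt.pathLT
  have hTS (hlt : PathLT T.position.path S.position.path) : T.position.LO S.position :=
    lo_of_pathLT (by rw [← source_eq, h, target_eq]) hlt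
  rcases LO.trichotomy (C := D₁.position) (D := T.position)
    (by rw [← source_eq, ← source_eq, h, hD₁]) with hlo | heq | hlo
  · exact hlo
  · obtain ⟨L, q, hpos⟩ := hS.created hT h (hTS (heq ▸ hlt₁))
    exact (not_created hpos hD (by rw [← hp, heq])).elim
  · obtain ⟨L, q, hpos⟩ := hS.created hT h (hTS (hlo.pathLT.trans hlt₁))
    exact (not_between hpos hD₁ hlo.pathLT hlt₁).elim

end Redex

theorem IsDerivation.source_eq_target {t u : Term} {ρ : List Redex} {S T : Redex}
    (h : IsDerivation t (S :: T :: ρ) u) : T.source = S.target := by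
  cases h with
  | cons _ _ _ _ _ _ h =>
    cases h with
    | cons _ _ _ _ _ h _ => exact h

theorem LOUDerivation.not_residual {σ : List Redex} {S R D : Redex} {t u : Term}
    (h : IsDerivation t (S :: (σ ++ [R])) u) (hlou : LOUDerivation (S :: (σ ++ [R])))
    (hD : D.source = S.source) (hlt : D.position.LO S.position) :
    ¬ Redex.Residual (S :: σ) D R := by
  induction σ generalizing S D t with
  | nil =>
    rintro ⟨D₁, -, hD₁, ho, rfl⟩
    exact ((hlou S (by simp)).residual_lo (hlou D₁ (by simp)) hD₁ hD hlt hD₁ ho).pathLT.irrefl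
  | cons T σ ih =>
    rintro ⟨D₁, -, hD₁, ho, hres⟩
    have hTS := h.source_eq_target
    have hlo := (hlou S (by simp)).residual_lo (hlou T (by simp)) hTS hD hlt hD₁ ho
    cases h with
    | cons _ _ _ _ _ _ h =>
      exact ih h (fun R' hR' => hlou R' (List.mem_cons_of_mem _ hR')) (hD₁.trans hTS.symm) hlo hres

theorem LOUDerivation.standard {t u : Term} {ρ : List Redex} (h : IsDerivation t ρ u)
    (hlou : LOUDerivation ρ) : Standard ρ := by
  rintro α S σ R β rfl D hD hlt
  obtain ⟨m, -, h⟩ := h.append_inv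
  rw [show S :: (σ ++ R :: β) = S :: (σ ++ [R]) ++ β by simp] at h hlou
  obtain ⟨m', h, -⟩ := h.append_inv
  exact LOUDerivation.not_residual h
    (fun R' hR' => hlou R' (List.mem_append_right _ (List.mem_append_left _ hR'))) hD hlt

/-! ### Linear size -/

theorem Ctx.size_plug_add (C : Ctx) (t u : Term) :
    (C.plug t).size + u.size = (C.plug u).size + t.size := by
  induction C <;> simp only [plug, Term.size] <;> omega

theorem Ctx.size_le_size_plug (C : Ctx) (t : Term) : t.size ≤ (C.plug t).size := by
  induction C <;> simp only [plug, Term.size] <;> omega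

theorem Term.Subterm.size_le {u t : Term} (h : u.Subterm t) : u.size ≤ t.size := by
  obtain ⟨C, rfl⟩ := h
  exact C.size_le_size_plug u

@[simp] theorem Term.size_shift (d : ℕ) (t : Term) : (t.shift d).size = t.size := by
  rw [← size_erase, erase_shift, size_erase]

theorem SubtermProperty.size_content_le {t u : Term} {ρ : List Redex} {D E : Ctx}
    (h : SubtermProperty t ρ) (hmem : Redex.ls D E u ∈ ρ) : u.size ≤ t.size := by
  simpa using (h D E u hmem).size_le

theorem Redex.size_target_db_le (C : Ctx) (L : List Term) (r p : Term) :
    (db C L r p).target.size ≤ (db C L r p).source.size := by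
  have h := C.size_plug_add ((ofSubst L).plug (Term.sub r (p.shift L.length)))
    (Term.app ((ofSubst L).plug (Term.lam r)) p)
  have h' := (ofSubst L).size_plug_add (Term.sub r (p.shift L.length)) (Term.lam r)
  simp only [Term.size, Term.size_shift] at h h'
  simp only [target, source]
  omega

theorem Redex.size_target_ls_le (D E : Ctx) (u : Term) :
    (ls D E u).target.size ≤ (ls D E u).source.size + u.size := by
  have h := (ls D E u).position.size_plug_add (ls D E u).after (ls D E u).before
  simp only [after, Term.size_shift] at h
  rw [source_eq, target_eq]
  simp only [after, before, Term.size] at h ⊢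
  omega

theorem SubtermProperty.size_le {t u : Term} {ρ : List Redex} (h : IsDerivation t ρ u)
    (hsub : SubtermProperty t ρ) : u.size ≤ (ρ.length + 1) * t.size := by
  induction ρ using List.reverseRecOn generalizing u with
  | nil => cases h; simp
  | append_singleton ρ R ih =>
    obtain ⟨h₁, -, rfl⟩ := h.snoc_inv
    have hle := ih h₁ fun D E v hv => hsub D E v (List.mem_append_left _ hv)
    rw [List.length_append, List.length_singleton, add_mul _ 1, one_mul]
    cases R with
    | db C L r p => exact (Redex.size_target_db_le C L r p).trans (hle.trans (Nat.le_add_right _ _))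
    | ls D E v =>
      exact (Redex.size_target_ls_le D E v).trans
        (Nat.add_le_add hle (hsub.size_content_le (D := D) (E := E) (by simp)))

/-! ### Terms and contexts in memory -/

theorem self_mem_cells (mem : ℕ → ℕ → ℕ) (a : ℕ) (t : Term) : a ∈ cells mem a t := by
  cases t <;> simp [cells]

theorem cells_congr {mem mem' : ℕ → ℕ → ℕ} {a : ℕ} {t : Term}
    (h : ∀ x ∈ cells mem a t, mem' x 1 = mem x 1 ∧ mem' x 2 = mem x 2) :
    cells mem' a t = cells mem a t := by
  induction t generalizing a with
  | var i => rfl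
  | lam t ih =>
    simp only [cells, List.mem_cons, forall_eq_or_imp] at h ⊢
    rw [h.1.1, ih h.2]
  | app t u iht ihu | sub t u iht ihu =>
    simp only [cells, List.mem_cons, List.mem_append, forall_eq_or_imp] at h ⊢
    rw [h.1.1, h.1.2, iht fun x hx => h.2 x (.inl hx), ihu fun x hx => h.2 x (.inr hx)]

@[simp] theorem cells_shift (mem : ℕ → ℕ → ℕ) (a d : ℕ) (t : Term) :
    cells mem a (t.shift d) = cells mem a t := by
  suffices ∀ c, cells mem a (Term.shiftFrom d c t) = cells mem a t from this 0
  induction t generalizing a with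
  | var i => intro c; simp only [Term.shiftFrom]; split <;> rfl
  | lam t ih => simp [Term.shiftFrom, cells, ih]
  | app t u iht ihu | sub t u iht ihu => simp [Term.shiftFrom, cells, iht, ihu]

/-- A stored term survives a change of memory outside its records, and it may be given a new
parent. -/
theorem Stored.reparent {mem mem' : ℕ → ℕ → ℕ} {Γ : List ℕ} {p p' a : ℕ} {t : Term}
    (h : Stored mem Γ p a t) (hnd : (cells mem a t).Nodup)
    (hm : ∀ x ∈ cells mem a t, ∀ g < 5, x ≠ a ∨ g ≠ 3 → mem' x g = mem x g)
    (hp : mem' a 3 = p') : Stored mem' Γ p' a t := by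
  have hroot : ∀ g < 5, g ≠ 3 → mem' a g = mem a g :=
    fun g hg h3 => hm a (self_mem_cells _ _ _) g hg (.inr h3)
  induction t generalizing Γ p p' a with
  | var i =>
    simp only [Stored] at h ⊢
    rw [hroot 0 (by omega) (by omega), hroot 4 (by omega) (by omega)]
    exact ⟨h.1, hp, h.2.2⟩
  | lam t ih =>
    simp only [Stored, cells, List.nodup_cons, List.mem_cons, forall_eq_or_imp] at h hnd hm ⊢
    have hm' : ∀ x ∈ cells mem (mem a 1) t, ∀ g < 5, mem' x g = mem x g :=
      fun x hx g hg => hm.2 x hx g hg (.inl (by rintro rfl; exact hnd.1 hx))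
    rw [hroot 0 (by omega) (by omega), hroot 1 (by omega) (by omega)]
    refine ⟨h.1, hp, ih h.2.2 hnd.2 (fun x hx g hg _ => hm' x hx g hg) ?_ ?_⟩
    · rw [hm' _ (self_mem_cells _ _ _) 3 (by omega)]
      cases t <;> exact h.2.2.2.1
    · exact fun g hg _ => hm' _ (self_mem_cells _ _ _) g hg
  | app t u iht ihu | sub t u iht ihu =>
    simp only [Stored, cells, List.nodup_cons, List.nodup_append, List.mem_cons, List.mem_append,
      forall_eq_or_imp, not_or] at h hnd hm ⊢
    have hmt : ∀ x ∈ cells mem (mem a 1) t, ∀ g < 5, mem' x g = mem x g :=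
      fun x hx g hg => hm.2 x (.inl hx) g hg (.inl (by rintro rfl; exact hnd.1.1 hx))
    have hmu : ∀ x ∈ cells mem (mem a 2) u, ∀ g < 5, mem' x g = mem x g :=
      fun x hx g hg => hm.2 x (.inr hx) g hg (.inl (by rintro rfl; exact hnd.1.2 hx))
    rw [hroot 0 (by omega) (by omega), hroot 1 (by omega) (by omega),
      hroot 2 (by omega) (by omega)]
    refine ⟨h.1, hp, iht h.2.2.1 hnd.2.1 (fun x hx g hg _ => hmt x hx g hg) ?_ ?_,
      ihu h.2.2.2 hnd.2.2.1 (fun x hx g hg _ => hmu x hx g hg) ?_ ?_⟩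
    · rw [hmt _ (self_mem_cells _ _ _) 3 (by omega)]
      cases t <;> exact h.2.2.1.2.1
    · exact fun g hg _ => hmt _ (self_mem_cells _ _ _) g hg
    · rw [hmu _ (self_mem_cells _ _ _) 3 (by omega)]
      cases u <;> exact h.2.2.2.2.1
    · exact fun g hg _ => hmu _ (self_mem_cells _ _ _) g hg

theorem Stored.parent {mem : ℕ → ℕ → ℕ} {Γ : List ℕ} {p a : ℕ} {t : Term}
    (h : Stored mem Γ p a t) : mem a 3 = p := by
  cases t <;> exact h.2.1

theorem Stored.frame {mem mem' : ℕ → ℕ → ℕ} {Γ : List ℕ} {p a : ℕ} {t : Term}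
    (h : Stored mem Γ p a t) (hm : ∀ x ∈ cells mem a t, ∀ g < 5, mem' x g = mem x g) :
    Stored mem' Γ p a t := by
  have hroot := hm a (self_mem_cells _ _ _)
  induction t generalizing Γ p a with
  | var i =>
    simp only [Stored] at h ⊢
    rwa [hroot 0 (by omega), hroot 3 (by omega), hroot 4 (by omega)]
  | lam t ih =>
    simp only [Stored, cells, List.mem_cons, forall_eq_or_imp] at h hm ⊢
    rw [hroot 0 (by omega), hroot 1 (by omega), hroot 3 (by omega)]
    exact ⟨h.1, h.2.1, ih h.2.2 hm.2 (hm.2 _ (self_mem_cells _ _ _))⟩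
  | app t u iht ihu | sub t u iht ihu =>
    simp only [Stored, cells, List.mem_cons, List.mem_append, forall_eq_or_imp] at h hm ⊢
    rw [hroot 0 (by omega), hroot 1 (by omega), hroot 2 (by omega), hroot 3 (by omega)]
    have hmt : ∀ x ∈ cells mem (mem a 1) t, ∀ g < 5, mem' x g = mem x g :=
      fun x hx => hm.2 x (.inl hx)
    have hmu : ∀ x ∈ cells mem (mem a 2) u, ∀ g < 5, mem' x g = mem x g :=
      fun x hx => hm.2 x (.inr hx)
    exact ⟨h.1, h.2.1, iht h.2.2.1 hmt (hmt _ (self_mem_cells _ _ _)),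
      ihu h.2.2.2 hmu (hmu _ (self_mem_cells _ _ _))⟩

/-- The index `i` occurs free in a term. -/
def Term.Free : ℕ → Term → Prop
  | i, var j => j = i
  | i, lam t => Free (i + 1) t
  | i, app t u => Free i t ∨ Free i u
  | i, sub t u => Free (i + 1) t ∨ Free i u

theorem Stored.congr_env {mem : ℕ → ℕ → ℕ} {Γ Γ' : List ℕ} {p a : ℕ} {t : Term}
    (h : Stored mem Γ p a t) (hΓ : ∀ i, t.Free i → Γ'[i]? = Γ[i]?) : Stored mem Γ' p a t := by
  have hcons {Γ Γ' : List ℕ} {t : Term} {b : ℕ} (h : ∀ i, t.Free (i + 1) → Γ'[i]? = Γ[i]?) :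
      ∀ i, t.Free i → (b :: Γ')[i]? = (b :: Γ)[i]? := by
    rintro (_ | i) hi
    · rfl
    · exact h i hi
  induction t generalizing Γ Γ' p a with
  | var i => exact ⟨h.1, h.2.1, (hΓ i rfl).trans h.2.2⟩
  | lam t ih => exact ⟨h.1, h.2.1, ih h.2.2 (hcons hΓ)⟩
  | app t u iht ihu =>
    exact ⟨h.1, h.2.1, iht h.2.2.1 fun i hi => hΓ i (.inl hi),
      ihu h.2.2.2 fun i hi => hΓ i (.inr hi)⟩
  | sub t u iht ihu =>
    exact ⟨h.1, h.2.1, iht h.2.2.1 (hcons fun i hi => hΓ i (.inl hi)),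
      ihu h.2.2.2 fun i hi => hΓ i (.inr hi)⟩

theorem Stored.shift {mem : ℕ → ℕ → ℕ} {Δ Γ : List ℕ} {p a : ℕ} {t : Term}
    (h : Stored mem Γ p a t) : Stored mem (Δ ++ Γ) p a (t.shift Δ.length) := by
  suffices ∀ Θ : List ℕ, Stored mem (Θ ++ Γ) p a t →
      Stored mem (Θ ++ (Δ ++ Γ)) p a (Term.shiftFrom Δ.length Θ.length t) from this [] h
  clear h
  intro Θ h
  induction t generalizing Θ p a with
  | var i =>
    simp only [Term.shiftFrom]
    simp only [Stored] at h
    split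
    · refine ⟨h.1, h.2.1, ?_⟩
      rw [List.getElem?_append_left ‹_›] at h ⊢
      exact h.2.2
    · refine ⟨h.1, h.2.1, ?_⟩
      rw [List.getElem?_append_right (by omega)] at h ⊢
      rw [List.getElem?_append_right (by omega)]
      rw [show i + Δ.length - Θ.length - Δ.length = i - Θ.length by omega]
      exact h.2.2
  | lam t ih => exact ⟨h.1, h.2.1, ih (a :: Θ) h.2.2⟩
  | app t u iht ihu => exact ⟨h.1, h.2.1, iht Θ h.2.2.1, ihu Θ h.2.2.2⟩
  | sub t u iht ihu => exact ⟨h.1, h.2.1, iht (a :: Θ) h.2.2.1, ihu Θ h.2.2.2⟩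

/-- `CtxStored mem Γ p f C Γ' p' f'`: the context `C` is stored between the field `f` of the record
`p`, which refers to its root, and the field `f'` of the record `p'`, which refers to what is in its
hole. Indices are represented by `Γ` outside and by `Γ'` in the hole. -/
def CtxStored (mem : ℕ → ℕ → ℕ) :
    List ℕ → ℕ → ℕ → Ctx → List ℕ → ℕ → ℕ → Prop
  | Γ, p, f, Ctx.hole, Γ', p', f' => Γ' = Γ ∧ p' = p ∧ f' = f
  | Γ, p, f, Ctx.lam C, Γ', p', f' => mem (mem p f) 0 = 1 ∧ mem (mem p f) 3 = p ∧
      CtxStored mem (mem p f :: Γ) (mem p f) 1 C Γ' p' f'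
  | Γ, p, f, Ctx.appL C u, Γ', p', f' => mem (mem p f) 0 = 2 ∧ mem (mem p f) 3 = p ∧
      CtxStored mem Γ (mem p f) 1 C Γ' p' f' ∧
      Stored mem Γ (mem p f) (mem (mem p f) 2) u
  | Γ, p, f, Ctx.appR t C, Γ', p', f' => mem (mem p f) 0 = 2 ∧ mem (mem p f) 3 = p ∧
      Stored mem Γ (mem p f) (mem (mem p f) 1) t ∧
      CtxStored mem Γ (mem p f) 2 C Γ' p' f'
  | Γ, p, f, Ctx.subL C u, Γ', p', f' => mem (mem p f) 0 = 3 ∧ mem (mem p f) 3 = p ∧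
      CtxStored mem (mem p f :: Γ) (mem p f) 1 C Γ' p' f' ∧
      Stored mem Γ (mem p f) (mem (mem p f) 2) u
  | Γ, p, f, Ctx.subR t C, Γ', p', f' => mem (mem p f) 0 = 3 ∧ mem (mem p f) 3 = p ∧
      Stored mem (mem p f :: Γ) (mem p f) (mem (mem p f) 1) t ∧
      CtxStored mem Γ (mem p f) 2 C Γ' p' f'

/-- The records of a context to which the field `f` of the record `p` refers. -/
def ctxCells (mem : ℕ → ℕ → ℕ) : ℕ → ℕ → Ctx → List ℕ
  | _, _, Ctx.hole => []
  | p, f, Ctx.lam C => mem p f :: ctxCells mem (mem p f) 1 C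
  | p, f, Ctx.appL C u => mem p f :: (ctxCells mem (mem p f) 1 C ++ cells mem (mem (mem p f) 2) u)
  | p, f, Ctx.appR t C => mem p f :: (cells mem (mem (mem p f) 1) t ++ ctxCells mem (mem p f) 2 C)
  | p, f, Ctx.subL C u => mem p f :: (ctxCells mem (mem p f) 1 C ++ cells mem (mem (mem p f) 2) u)
  | p, f, Ctx.subR t C => mem p f :: (cells mem (mem (mem p f) 1) t ++ ctxCells mem (mem p f) 2 C)

theorem stored_plug {mem : ℕ → ℕ → ℕ} {C : Ctx} {t : Term} {Γ : List ℕ} {p f : ℕ} :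
    Stored mem Γ p (mem p f) (C.plug t) ↔ ∃ Γ' p' f', CtxStored mem Γ p f C Γ' p' f' ∧
      Stored mem Γ' p' (mem p' f') t := by
  induction C generalizing Γ p f with
  | hole => simp [CtxStored, Ctx.plug]
  | lam C ih | appL C u ih | appR u C ih | subL C u ih | subR u C ih =>
    simp only [Ctx.plug, Stored, CtxStored, ih]
    grind

theorem CtxStored.cells_plug {mem : ℕ → ℕ → ℕ} {C : Ctx} {Γ Γ' : List ℕ} {p f p' f' : ℕ}
    (h : CtxStored mem Γ p f C Γ' p' f') (t : Term) :
    (cells mem (mem p f) (C.plug t)).Perm (ctxCells mem p f C ++ cells mem (mem p' f') t) := by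
  induction C generalizing Γ p f with
  | hole => obtain ⟨-, rfl, rfl⟩ := h; exact .refl _
  | lam C ih => exact (ih h.2.2).cons _
  | appL C u ih | subL C u ih =>
    simp only [ctxCells, cells, Ctx.plug, List.cons_append, List.append_assoc]
    refine List.Perm.cons _ (((ih h.2.2.1).append_right _).trans ?_)
    rw [List.append_assoc]
    exact List.perm_append_comm.append_left _
  | appR u C ih | subR u C ih =>
    simp only [ctxCells, cells, Ctx.plug, List.cons_append, List.append_assoc]
    exact List.Perm.cons _ ((ih h.2.2.2).append_left _)

theorem follow_append (mem : ℕ → ℕ → ℕ) (a : ℕ) (p q : List Dir) :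
    follow mem a (p ++ q) = follow mem (follow mem a p) q := by
  induction p generalizing a with
  | nil => rfl
  | cons d p ih => cases d <;> exact ih _

theorem CtxStored.follow_path {mem : ℕ → ℕ → ℕ} {C : Ctx} {Γ Γ' : List ℕ} {p f p' f' : ℕ}
    (h : CtxStored mem Γ p f C Γ' p' f') : follow mem (mem p f) C.path = mem p' f' := by
  induction C generalizing Γ p f with
  | hole => obtain ⟨-, rfl, rfl⟩ := h; rfl
  | lam C ih => exact ih h.2.2
  | appL C u ih | subL C u ih => exact ih h.2.2.1
  | appR u C ih | subR u C ih => exact ih h.2.2.2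

theorem CtxStored.env {mem : ℕ → ℕ → ℕ} {C : Ctx} {Γ Γ' : List ℕ} {p f p' f' : ℕ}
    (h : CtxStored mem Γ p f C Γ' p' f') : ∃ Δ, Γ' = Δ ++ Γ ∧ Δ.length = C.depth := by
  have snoc {Γ' Γ : List ℕ} {n b : ℕ} (h : ∃ Δ, Γ' = Δ ++ b :: Γ ∧ Δ.length = n) :
      ∃ Δ, Γ' = Δ ++ Γ ∧ Δ.length = n + 1 := by
    obtain ⟨Δ, rfl, rfl⟩ := h
    exact ⟨Δ ++ [b], by simp, by simp⟩
  induction C generalizing Γ p f with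
  | hole => obtain ⟨rfl, -, -⟩ := h; exact ⟨[], rfl, rfl⟩
  | lam C ih => exact snoc (ih h.2.2)
  | appL C u ih => exact ih h.2.2.1
  | subL C u ih => exact snoc (ih h.2.2.1)
  | appR u C ih | subR u C ih => exact ih h.2.2.2

theorem CtxStored.mem_ctxCells {mem : ℕ → ℕ → ℕ} {C : Ctx} {Γ Γ' : List ℕ} {p f p' f' : ℕ}
    (h : CtxStored mem Γ p f C Γ' p' f') : p' = p ∧ f' = f ∨ p' ∈ ctxCells mem p f C := by
  induction C generalizing Γ p f with
  | hole => exact .inl h.2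
  | lam C ih =>
    simp only [ctxCells, List.mem_cons]
    have := ih h.2.2
    tauto
  | appL C u ih | subL C u ih =>
    simp only [ctxCells, List.mem_cons, List.mem_append]
    have := ih h.2.2.1
    tauto
  | appR u C ih | subR u C ih =>
    simp only [ctxCells, List.mem_cons, List.mem_append]
    have := ih h.2.2.2
    tauto

/-- If the hole hangs on the second field of a record, then the first field of that record refers
to another record of the context. -/
theorem CtxStored.slot {mem : ℕ → ℕ → ℕ} {C : Ctx} {Γ Γ' : List ℕ} {p f p' f' : ℕ}
    (h : CtxStored mem Γ p f C Γ' p' f') :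
    p' = p ∧ f' = f ∨ f' = 1 ∨ f' = 2 ∧ mem p' 1 ∈ ctxCells mem p f C := by
  induction C generalizing Γ p f with
  | hole => exact .inl h.2
  | lam C ih =>
    simp only [ctxCells, List.mem_cons]
    have := ih h.2.2
    tauto
  | appL C u ih | subL C u ih =>
    simp only [ctxCells, List.mem_cons, List.mem_append]
    have := ih h.2.2.1
    tauto
  | appR u C ih | subR u C ih =>
    simp only [ctxCells, List.mem_cons, List.mem_append]
    rcases ih h.2.2.2 with ⟨rfl, rfl⟩ | h | h
    · exact .inr (.inr ⟨rfl, .inr (.inl (self_mem_cells _ _ _))⟩)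
    · exact .inr (.inl h)
    · exact .inr (.inr ⟨h.1, .inr (.inr h.2)⟩)

/-- A stored context survives a change of memory that concerns, among its fields, at most the one
that refers to the hole. -/
theorem CtxStored.frame {mem mem' : ℕ → ℕ → ℕ} {C : Ctx} {Γ Γ' : List ℕ} {p f p' f' : ℕ}
    (h : CtxStored mem Γ p f C Γ' p' f') (hnd : (p :: ctxCells mem p f C).Nodup)
    (hpf : p ≠ p' ∨ f ≠ f' → mem' p f = mem p f)
    (hm : ∀ x ∈ ctxCells mem p f C, ∀ g < 5, x ≠ p' ∨ g ≠ f' → mem' x g = mem x g) :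
    CtxStored mem' Γ p f C Γ' p' f' ∧ ctxCells mem' p f C = ctxCells mem p f C := by
  induction C generalizing Γ p f with
  | hole => exact ⟨h, rfl⟩
  | lam C ih =>
    have hin := h.2.2.mem_ctxCells
    have hsl := h.2.2.slot
    simp only [ctxCells, List.nodup_cons, List.mem_cons, not_or] at hnd hm ⊢
    have hp : mem' p f = mem p f := hpf (.inl (by grind))
    obtain ⟨h₁, h₂⟩ := ih h.2.2 (List.nodup_cons.2 hnd.2) (by grind) (by grind)
    simp only [CtxStored, hp]
    rw [hm _ (.inl rfl) 0 (by omega) (by grind), hm _ (.inl rfl) 3 (by omega) (by grind), h₂]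
    exact ⟨⟨h.1, h.2.1, h₁⟩, rfl⟩
  | appL C u ih | subL C u ih =>
    have hin := h.2.2.1.mem_ctxCells
    have hsl := h.2.2.1.slot
    simp only [ctxCells, List.nodup_cons, List.nodup_append, List.mem_cons, List.mem_append,
      not_or] at hnd hm ⊢
    have hp : mem' p f = mem p f := hpf (.inl (by grind))
    have h2 : mem' (mem p f) 2 = mem (mem p f) 2 := hm _ (.inl rfl) 2 (by omega) (by grind)
    obtain ⟨h₁, h₂⟩ := ih h.2.2.1 (List.nodup_cons.2 ⟨hnd.2.1.1, hnd.2.2.1⟩) (by grind) (by grind)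
    have hu : ∀ x ∈ cells mem (mem (mem p f) 2) u, ∀ g < 5, mem' x g = mem x g := by grind
    simp only [CtxStored, hp, h2]
    rw [hm _ (.inl rfl) 0 (by omega) (by grind), hm _ (.inl rfl) 3 (by omega) (by grind), h₂,
      cells_congr fun x hx => ⟨hu x hx 1 (by omega), hu x hx 2 (by omega)⟩]
    exact ⟨⟨h.1, h.2.1, h₁, h.2.2.2.frame hu⟩, rfl⟩
  | appR u C ih | subR u C ih =>
    have hin := h.2.2.2.mem_ctxCells
    have hsl := h.2.2.2.slot
    simp only [ctxCells, List.nodup_cons, List.nodup_append, List.mem_cons, List.mem_append,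
      not_or] at hnd hm ⊢
    have hp : mem' p f = mem p f := hpf (.inl (by grind))
    have h2 : mem' (mem p f) 1 = mem (mem p f) 1 := hm _ (.inl rfl) 1 (by omega) (by grind)
    obtain ⟨h₁, h₂⟩ := ih h.2.2.2 (List.nodup_cons.2 ⟨hnd.2.1.2, hnd.2.2.2.1⟩) (by grind)
      (by grind)
    have hu : ∀ x ∈ cells mem (mem (mem p f) 1) u, ∀ g < 5, mem' x g = mem x g := by grind
    simp only [CtxStored, hp, h2]
    rw [hm _ (.inl rfl) 0 (by omega) (by grind), hm _ (.inl rfl) 3 (by omega) (by grind), h₂,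
      cells_congr fun x hx => ⟨hu x hx 1 (by omega), hu x hx 2 (by omega)⟩]
    exact ⟨⟨h.1, h.2.1, h.2.2.1.frame hu, h₁⟩, rfl⟩

/-! ### The two kinds of steps in memory -/

/-- The memory after storing `v` in the field `f` of the record `x`. -/
def write (mem : ℕ → ℕ → ℕ) (x f v : ℕ) : ℕ → ℕ → ℕ :=
  Function.update mem x (Function.update (mem x) f v)

theorem write_apply (mem : ℕ → ℕ → ℕ) (x f v y g : ℕ) :
    write mem x f v y g = if y = x ∧ g = f then v else mem y g := by
  simp only [write, Function.update_apply]
  split_ifs <;> simp_all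

theorem depth_ofSubst (L : List Term) : (ofSubst L).depth = L.length := by
  induction L <;> simp_all [ofSubst, depth]

/-- A list of explicit substitutions taken from one place and attached to another one. -/
theorem CtxStored.attach {mem mem' : ℕ → ℕ → ℕ} {Γ Γ' : List ℕ} {a p p' f f' : ℕ} {L : List Term}
    (h : CtxStored mem Γ a 1 (ofSubst L) Γ' p' f')
    (hnd : (ctxCells mem a 1 (ofSubst L)).Nodup)
    (hp : mem' p f = mem a 1) (hf : mem' (mem a 1) 3 = p)
    (hm : ∀ x ∈ ctxCells mem a 1 (ofSubst L), ∀ g < 5, x ≠ mem a 1 ∨ g ≠ 3 → mem' x g = mem x g)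
    (hl : mem a 1 ≠ mem p' f' → mem' (mem p' f') 3 = p')
    (hne : mem p' f' ∉ ctxCells mem a 1 (ofSubst L)) :
    ∃ p'' f'', CtxStored mem' Γ p f (ofSubst L) Γ' p'' f'' ∧ mem' p'' f'' = mem p' f' ∧
      mem' (mem p' f') 3 = p'' ∧
      ctxCells mem' p f (ofSubst L) = ctxCells mem a 1 (ofSubst L) := by
  cases L with
  | nil =>
    obtain ⟨rfl, rfl, rfl⟩ := h
    exact ⟨p, f, ⟨rfl, rfl, rfl⟩, hp, hf, rfl⟩
  | cons q L =>
    obtain ⟨hq₀, -, hq, hq₂⟩ := h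
    set fn := mem a 1 with hfn
    simp only [ofSubst, ctxCells, ← hfn, List.nodup_cons, List.nodup_append, List.mem_cons,
      List.mem_append, not_or] at hnd hm hq₀ hq hq₂ hne ⊢
    have hsl := hq.slot
    have hin := hq.mem_ctxCells
    obtain ⟨hq', hcq⟩ := hq.frame (mem' := mem') (by simp only [List.nodup_cons]; grind)
      (by grind) (by grind)
    have hmq : ∀ x ∈ cells mem (mem fn 2) q, ∀ g < 5, mem' x g = mem x g := by grind
    have hm2 : mem' fn 2 = mem fn 2 := by grind
    refine ⟨p', f', ?_, by grind, hl (Ne.symm hne.1), ?_⟩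
    · simp only [CtxStored, hp, hm2]
      exact ⟨by grind, hf, hq', hq₂.frame hmq⟩
    · rw [hp, hcq, hm2, cells_congr fun x hx => ⟨hmq x hx 1 (by omega), hmq x hx 2 (by omega)⟩]

set_option maxHeartbeats 1000000 in
/-- A `db` step in memory: the function part of the application takes its place, and the record of
the abstraction becomes that of the explicit substitution. Here `a` and `l` are the records of the
application and of the abstraction, and `f₁` is the field of the parent `p₁` that refers to `a`. -/
theorem Represents.db {s : State} {root : ℕ} {Γ : List ℕ} {C : Ctx} {L : List Term} {r p : Term}
    (h : Represents s root Γ (Redex.db C L r p).source) :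
    ∃ a l p₁ f₁, (Redex.db C L r p).handles s.mem (s.mem root 1) = [a, l] ∧
      s.mem a 0 = 2 ∧ s.mem a 3 = p₁ ∧ (f₁ = 1 ∧ s.mem p₁ 1 = a ∨ f₁ = 2 ∧ s.mem p₁ 1 ≠ a) ∧
      ∀ s' : State, s'.next = s.next →
        s'.mem = write (write (write (write (write s.mem p₁ f₁ (s.mem a 1)) (s.mem a 1) 3 p₁)
          l 0 3) l 2 (s.mem a 2)) (s.mem a 2) 3 l →
        Represents s' root Γ (Redex.db C L r p).target := by
  obtain ⟨hst, hnd, hlt⟩ := h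
  rcases s with ⟨reg, mem, next⟩
  simp only [Redex.source] at hst hnd hlt ⊢
  obtain ⟨Γ₁, p₁, f₁, hC, htag, hpar, hfun, harg⟩ := stored_plug.1 hst
  obtain ⟨Γ₂, p₂, f₂, hL, hlam⟩ := stored_plug.1 hfun
  have hperm : (cells mem (mem root 1) (C.plug (((ofSubst L).plug r.lam).app p))).Perm
      (ctxCells mem root 1 C ++ mem p₁ f₁ :: ((ctxCells mem (mem p₁ f₁) 1 (ofSubst L) ++
        mem p₂ f₂ :: cells mem (mem (mem p₂ f₂) 1) r) ++ cells mem (mem (mem p₁ f₁) 2) p)) :=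
    (hC.cells_plug _).trans (List.Perm.append_left _ (((hL.cells_plug _).append_right _).cons _))
  have hnd' := ((hperm.append_left Γ).cons root).nodup_iff.1 hnd
  have hC₁ := hC.mem_ctxCells
  have hC₂ := hC.slot
  have hb := self_mem_cells mem (mem (mem p₁ f₁) 2) p
  simp only [List.nodup_cons, List.nodup_append, List.mem_cons, List.mem_append, not_or] at hnd'
  set a := mem p₁ f₁ with ha
  set l := mem p₂ f₂ with hl
  set b := mem a 2 with hb'
  have hf : f₁ = 1 ∨ f₁ = 2 := by grind
  refine ⟨a, l, p₁, f₁, ?_, htag, hpar, ?_, ?_⟩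
  · have := hL.follow_path
    rw [path_ofSubst] at this
    simp [Redex.handles, follow_append, hC.follow_path, follow, ← ha, ← hl, this]
  · grind
  · rintro ⟨reg', mem', next'⟩ hnext hmem
    simp only at hnext hmem
    set fn := mem a 1 with hfn
    -- The abstraction itself is the function part of the application if `L` is empty.
    have hfn' : L = [] ∧ fn = l ∨ fn ∈ ctxCells mem a 1 (ofSubst L) := by
      cases L with
      | nil => obtain ⟨-, rfl, rfl⟩ := hL; exact .inl ⟨rfl, rfl⟩
      | cons q L => exact .inr List.mem_cons_self
    -- Only five fields of the old memory are overwritten.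
    have hm : ∀ x g, ¬ (x = p₁ ∧ g = f₁) → ¬ (x = fn ∧ g = 3) → ¬ (x = l ∧ (g = 0 ∨ g = 2)) →
        ¬ (x = b ∧ g = 3) → mem' x g = mem x g := by
      intro x g h₁ h₂ h₃ h₄
      simp only [hmem, write_apply]
      grind
    rw [← hb'] at hmem
    have hmb : mem' b 3 = l := by simp [hmem, write_apply]
    have hml2 : mem' l 2 = b := by simp [hmem, write_apply]
    have hml0 : mem' l 0 = 3 := by simp [hmem, write_apply]
    have hmf : mem' fn 3 = p₁ := by simp only [hmem, write_apply]; grind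
    have hmp : mem' p₁ f₁ = fn := by simp only [hmem, write_apply]; grind
    clear_value a l b fn
    clear hmem
    obtain ⟨hC', hcC⟩ := hC.frame (mem' := mem')
      (by simp only [List.nodup_cons]; grind) (by grind) (by grind)
    obtain ⟨p₂', f₂', hL', hml, hpl, hcL⟩ : ∃ p₂' f₂',
        CtxStored mem' Γ₁ p₁ f₁ (ofSubst L) Γ₂ p₂' f₂' ∧ mem' p₂' f₂' = l ∧ mem' l 3 = p₂' ∧
        ctxCells mem' p₁ f₁ (ofSubst L) = ctxCells mem a 1 (ofSubst L) := by
      have := hlam.parent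
      have hfl : fn ∈ ctxCells mem a 1 (ofSubst L) → fn ≠ l := by grind
      have hbL : b ∉ ctxCells mem a 1 (ofSubst L) ∧ b ≠ l := by grind
      rw [hl]
      refine hL.attach (by grind) (by grind) (by grind) ?_ ?_ (by grind)
      · intro x hx g hg hne
        apply hm <;> grind
      · intro hne
        rw [← hl, ← this]
        rw [← hl, ← hfn] at hne
        apply hm <;> grind
    have hr : ∀ x ∈ cells mem (mem l 1) r, ∀ g < 5, mem' x g = mem x g := by grind
    have hml1 : mem' l 1 = mem l 1 := by grind
    have hcr := cells_congr fun x hx => ⟨hr x hx 1 (by omega), hr x hx 2 (by omega)⟩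
    have hcp : cells mem' b p = cells mem b p := by
      refine cells_congr fun x hx => ⟨?_, ?_⟩ <;> grind
    have hp : Stored mem' Γ₁ l b p := harg.reparent (by grind) (by grind) hmb
    have hnew : Stored mem' Γ₂ p₂' l (Term.sub r (p.shift L.length)) := by
      refine ⟨hml0, hpl, ?_, ?_⟩
      · rw [hml1]
        exact hlam.2.2.frame hr
      · rw [hml2]
        obtain ⟨Δ, rfl, hΔ⟩ := hL.env
        rw [← depth_ofSubst L, ← hΔ]
        exact hp.shift
    have hst' : Stored mem' Γ root (mem' root 1) (Redex.db C L r p).target := by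
      refine stored_plug.2 ⟨_, _, _, hC', stored_plug.2 ⟨_, _, _, hL', ?_⟩⟩
      rwa [hml]
    have hperm' : (a :: cells mem' (mem' root 1) (Redex.db C L r p).target).Perm
        (cells mem (mem root 1) (C.plug (((ofSubst L).plug r.lam).app p))) := by
      refine .trans ?_ hperm.symm
      refine (((hC'.cells_plug _).trans ((hL'.cells_plug _).append_left _)).cons a).trans ?_
      rw [hcC, hcL, hml]
      simp only [cells, hml1, hml2, hcr, cells_shift, hcp]
      refine List.perm_middle.symm.trans (List.Perm.of_eq ?_)
      simp
    have hperm'' : (a :: root :: (Γ ++ cells mem' (mem' root 1) (Redex.db C L r p).target)).Perm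
        (root :: (Γ ++ cells mem (mem root 1) (C.plug (((ofSubst L).plug r.lam).app p)))) :=
      (List.perm_middle (l₁ := root :: Γ)).symm.trans (hperm'.append_left (root :: Γ))
    refine ⟨hst', (List.nodup_cons.1 (hperm''.nodup_iff.2 hnd)).2, fun x hx => ?_⟩
    simp only [hnext]
    exact hlt x (hperm''.subset (List.mem_cons_of_mem _ hx))

theorem CtxStored.comp {mem : ℕ → ℕ → ℕ} {C D : Ctx} {Γ Γ₁ Γ₂ : List ℕ} {p f p₁ f₁ p₂ f₂ : ℕ}
    (h : CtxStored mem Γ p f C Γ₁ p₁ f₁) (h' : CtxStored mem Γ₁ p₁ f₁ D Γ₂ p₂ f₂) :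
    CtxStored mem Γ p f (C.comp D) Γ₂ p₂ f₂ := by
  induction C generalizing Γ p f with
  | hole => obtain ⟨rfl, rfl, rfl⟩ := h; exact h'
  | lam C ih => exact ⟨h.1, h.2.1, ih h.2.2⟩
  | appL C u ih | subL C u ih => exact ⟨h.1, h.2.1, ih h.2.2.1, h.2.2.2⟩
  | appR u C ih | subR u C ih => exact ⟨h.1, h.2.1, h.2.2.1, ih h.2.2.2⟩

theorem CtxStored.mem_or_mem_of_mem_env {mem : ℕ → ℕ → ℕ} {C : Ctx} {Γ Γ' : List ℕ}
    {p f p' f' : ℕ} (h : CtxStored mem Γ p f C Γ' p' f') :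
    ∀ x ∈ Γ', x ∈ Γ ∨ x ∈ ctxCells mem p f C := by
  induction C generalizing Γ p f with
  | hole => obtain ⟨rfl, -, -⟩ := h; exact fun x hx => .inl hx
  | lam C ih =>
    intro x hx
    have := ih h.2.2 x hx
    simp only [ctxCells, List.mem_cons] at this ⊢
    tauto
  | appL C u ih | subL C u ih =>
    intro x hx
    have := ih h.2.2.1 x hx
    simp only [ctxCells, List.mem_cons, List.mem_append] at this ⊢
    tauto
  | appR u C ih | subR u C ih =>
    intro x hx
    have := ih h.2.2.2 x hx
    simp only [ctxCells, List.mem_cons, List.mem_append] at this ⊢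
    tauto

/-- An `ls` step in memory: a copy `w` of the content, made of new records, takes the place of the
variable occurrence `x`, to which the field `f₂` of its parent `p₂` refers. Here `b` is the binder
of `x`, and `Γ₁` represents the indices outside the explicit substitution. -/
theorem Represents.ls {s : State} {root : ℕ} {Γ : List ℕ} {D E : Ctx} {u : Term}
    (h : Represents s root Γ (Redex.ls D E u).source) :
    ∃ x b p₂ f₂ Γ₁, (Redex.ls D E u).handles s.mem (s.mem root 1) = [x] ∧
      s.mem x 0 = 0 ∧ s.mem x 4 = b ∧ s.mem x 3 = p₂ ∧
      (f₂ = 1 ∧ s.mem p₂ 1 = x ∨ f₂ = 2 ∧ s.mem p₂ 1 ≠ x) ∧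
      Stored s.mem Γ₁ b (s.mem b 2) u ∧ (cells s.mem (s.mem b 2) u).Nodup ∧
      (∀ y ∈ Γ₁, y ∉ cells s.mem (s.mem b 2) u ∧ y < s.next) ∧
      (∀ y ∈ cells s.mem (s.mem b 2) u, y < s.next) ∧ x < s.next ∧ p₂ < s.next ∧
      ∀ (s' : State) (mem₁ : ℕ → ℕ → ℕ) (w : ℕ), s.next ≤ s'.next →
        (∀ y < s.next, ∀ g < 5, mem₁ y g = s.mem y g) → Stored mem₁ Γ₁ p₂ w u →
        (cells mem₁ w u).Nodup → (∀ y ∈ cells mem₁ w u, s.next ≤ y ∧ y < s'.next) →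
        s'.mem = write mem₁ p₂ f₂ w → Represents s' root Γ (Redex.ls D E u).target := by
  obtain ⟨hst, hnd, hlt⟩ := h
  rcases s with ⟨reg, mem, next⟩
  have hsrc := (Redex.ls D E u).source_eq
  simp only [Redex.source] at hst hnd hlt hsrc ⊢
  obtain ⟨Γ₁, p₁, f₁, hD, htag, hpar, hbody, hu⟩ := stored_plug.1 hst
  obtain ⟨Γ₂, p₂, f₂, hE, hx⟩ := stored_plug.1 hbody
  have hK : CtxStored mem Γ root 1 (Redex.ls D E u).position Γ₂ p₂ f₂ :=
    hD.comp ⟨htag, hpar, hE, hu⟩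
  have hpermK := hK.cells_plug (Redex.ls D E u).before
  rw [← hsrc] at hpermK
  have hperm := hD.cells_plug (Term.sub (E.plug (Term.var E.depth)) u)
  obtain ⟨Δ, hΔ, hlen⟩ := hE.env
  have hslot := hK.slot
  have hmemK := hK.mem_ctxCells
  have hpath := hK.follow_path
  have henv := hD.mem_or_mem_of_mem_env
  simp only [Redex.before, cells] at hpermK hperm
  set x := mem p₂ f₂ with hxdef
  set b := mem p₁ f₁ with hb
  have hlt' := hlt
  simp only [List.mem_cons, List.mem_append, hpermK.mem_iff] at hlt
  simp only [List.mem_cons, List.mem_append, hperm.mem_iff] at hlt'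
  have hndK := ((hpermK.append_left Γ).cons root).nodup_iff.1 hnd
  have hndD := ((hperm.append_left Γ).cons root).nodup_iff.1 hnd
  simp only [List.nodup_cons, List.nodup_append, List.mem_cons, List.mem_append, not_or]
    at hndK hndD
  obtain ⟨hx0, hx3, hx4⟩ := hx
  have hxb : mem x 4 = b := by
    rw [hΔ, List.getElem?_append_right (by omega), hlen, Nat.sub_self] at hx4
    simpa using hx4.symm
  refine ⟨x, b, p₂, f₂, Γ₁, by rw [Redex.handles, hpath], hx0, hxb, hx3, by grind, hu, by grind,
    by grind, by grind, by grind, by grind, ?_⟩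
  rintro ⟨reg', mem₂, next'⟩ mem₁ w hnext hold hw hwnd hwlt hmem
  simp only at hnext hold hw hwnd hwlt hmem hlt
  have hm : ∀ y g, ¬ (y = p₂ ∧ g = f₂) → mem₂ y g = mem₁ y g := by
    intro y g hy
    rw [hmem, write_apply, if_neg hy]
  have hm₂ : mem₂ p₂ f₂ = w := by simp [hmem, write_apply]
  clear hmem
  have hp₂ : p₂ < next := by grind
  obtain ⟨hK', hcK⟩ := hK.frame (mem' := mem₂) (by simp only [List.nodup_cons]; grind)
    (by grind) (by grind)
  have hmw : ∀ y ∈ cells mem₁ w u, ∀ g < 5, mem₂ y g = mem₁ y g := by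
    intro y hy g hg
    have := hwlt y hy
    exact hm y g (by omega)
  have hcw := cells_congr fun y hy => ⟨hmw y hy 1 (by omega), hmw y hy 2 (by omega)⟩
  have hnew : Stored mem₂ Γ₂ p₂ w (u.shift (E.depth + 1)) := by
    have := (hw.frame hmw).shift (Δ := Δ ++ [b])
    rwa [List.length_append, List.length_singleton, hlen, List.append_assoc,
      List.singleton_append, ← hΔ] at this
  have hst' : Stored mem₂ Γ root (mem₂ root 1) (Redex.ls D E u).target := by
    rw [Redex.target_eq]
    exact stored_plug.2 ⟨_, _, _, hK', hm₂.symm ▸ hnew⟩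
  have hperm' : (cells mem₂ (mem₂ root 1) (Redex.ls D E u).target).Perm
      (ctxCells mem root 1 (Redex.ls D E u).position ++ cells mem₁ w u) := by
    rw [Redex.target_eq]
    refine (hK'.cells_plug _).trans (List.Perm.of_eq ?_)
    rw [hcK, hm₂, Redex.after, cells_shift, hcw]
  have hperm'' := (hperm'.append_left Γ).cons root
  refine ⟨hst', hperm''.nodup_iff.2 ?_, fun y hy => ?_⟩
  · simp only [List.nodup_cons, List.nodup_append, List.mem_append, not_or]
    grind
  · have := hperm''.subset hy
    simp only [List.mem_cons, List.mem_append] at this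
    grind

/-! ### The program -/

/-- A sequence of commands. -/
def Cmd.block : List Cmd → Cmd
  | [] => Cmd.skip
  | c :: l => Cmd.seq c (block l)

/-- Contracts a `db` redex, with the application in register `0` and the abstraction in
register `1`. -/
def dbStep : Cmd :=
  .block [.load 2 0 3, .load 3 0 1, .load 4 0 2, .load 5 2 1,
    .ifEq 5 0 (.store 2 1 3) (.store 2 2 3), .store 3 3 2, .const 6 3, .store 1 0 6, .store 1 2 4,
    .store 4 3 1]

/-- Contracts an `ls` redex, with the variable occurrence in register `0`. -/
def lsStep : Cmd :=
  .block [.load 2 0 4, .load 3 2 2, .call 4 1 [3], .load 5 0 3, .call 6 2 [3, 5], .load 7 5 1,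
    .ifEq 7 0 (.store 5 1 6) (.store 5 2 6)]

/-- Contracts the redex in registers `0` and `1`. -/
def contract : Cmd :=
  .block [.load 2 0 0, .const 3 0, .ifEq 2 3 lsStep dbStep]

/-- For every variable occurrence in the term in register `0`, the field `5` of its binder is set
to the binder itself. The tag `0` is that of a variable, the tag `1` that of an abstraction, which
has only one subterm. -/
def resetBinders : Cmd :=
  .block [.load 1 0 0, .const 2 0,
    .ifEq 1 2
      (.block [.load 3 0 4, .store 3 5 3])
      (.block [.load 3 0 1, .call 4 1 [3], .const 2 1,
        .ifEq 1 2 .skip (.block [.load 3 0 2, .call 4 1 [3]])])]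

/-- Copies the term in register `0`, with the parent in register `1`, and leaves the copy in
register `0`. The field `5` of every record that has been copied refers to the copy, and the binder
of a copied variable is the field `5` of the binder of the original. After `resetBinders`, that
field refers to the binder itself for the variables that are free in the term. -/
def copyTerm : Cmd :=
  .block [.alloc 2, .load 3 0 0, .store 2 0 3, .store 2 3 1, .store 0 5 2, .const 4 0,
    .ifEq 3 4
      (.block [.load 5 0 4, .load 5 5 5, .store 2 4 5])
      (.block [.load 5 0 1, .call 6 2 [5, 2], .store 2 1 6, .const 4 1,
        .ifEq 3 4 .skip (.block [.load 5 0 2, .call 6 2 [5, 2], .store 2 2 6])]),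
    .move 0 2]

/-- The program that implements all redexes. The calls of procedures `1` and `2` in the commands
above refer to their positions in this list. -/
def program : List Cmd := [contract, resetBinders, copyTerm]

/-! ### Running commands -/

/-- The command `c` of `program`, started in the state `s`, terminates, and its time and final
state satisfy `Q`. -/
def Runs (c : Cmd) (s : State) (Q : ℕ → State → Prop) : Prop :=
  ∃ n s', Exec program c s n s' ∧ Q n s'

namespace Runs

variable {s : State} {Q Q' : ℕ → State → Prop}

theorem mono {c : Cmd} (h : Runs c s Q) (hQ : ∀ n s', Q n s' → Q' n s') : Runs c s Q' := by
  obtain ⟨n, s', h, hq⟩ := h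
  exact ⟨n, s', h, hQ _ _ hq⟩

theorem skip (h : Q 1 s) : Runs .skip s Q := ⟨_, _, .skip s, h⟩

theorem const {r n : ℕ} (h : Q 1 (s.setReg r n)) : Runs (.const r n) s Q :=
  ⟨_, _, .const s r n, h⟩

theorem move {r q : ℕ} (h : Q 1 (s.setReg r (s.reg q))) : Runs (.move r q) s Q :=
  ⟨_, _, .move s r q, h⟩

theorem load {r q f : ℕ} (h : Q 1 (s.setReg r (s.mem (s.reg q) f))) : Runs (.load r q f) s Q :=
  ⟨_, _, .load s r q f, h⟩

theorem store {r f q : ℕ} (h : Q 1 { s with mem := write s.mem (s.reg r) f (s.reg q) }) :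
    Runs (.store r f q) s Q :=
  ⟨_, _, .store s r f q, h⟩

theorem alloc {r : ℕ} (h : Q 1 { s.setReg r s.next with next := s.next + 1 }) :
    Runs (.alloc r) s Q :=
  ⟨_, _, .alloc s r, h⟩

theorem nil (h : Q 1 s) : Runs (.block []) s Q := skip h

theorem cons {c : Cmd} {l : List Cmd}
    (h : Runs c s fun m s₁ => Runs (.block l) s₁ fun n s₂ => Q (m + n) s₂) :
    Runs (.block (c :: l)) s Q := by
  obtain ⟨m, s₁, h₁, n, s₂, h₂, h⟩ := h
  exact ⟨_, _, .seq _ _ _ _ _ _ _ h₁ h₂, h⟩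

theorem ifEq {r q : ℕ} {c d : Cmd}
    (h₁ : s.reg r = s.reg q → Runs c s fun n => Q (n + 1))
    (h₂ : s.reg r ≠ s.reg q → Runs d s fun n => Q (n + 1)) : Runs (.ifEq r q c d) s Q := by
  by_cases h : s.reg r = s.reg q
  · obtain ⟨n, s', h', hq⟩ := h₁ h
    exact ⟨_, _, .ifTrue _ _ _ _ _ _ _ h h', hq⟩
  · obtain ⟨n, s', h', hq⟩ := h₂ h
    exact ⟨_, _, .ifFalse _ _ _ _ _ _ _ h h', hq⟩

theorem call {r p : ℕ} {args : List ℕ} {b : Cmd} (hp : program[p]? = some b)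
    (h : Runs b { s with reg := fun i => (args.map s.reg).getD i 0 } fun n s₁ =>
      Q (n + 1) { s₁ with reg := Function.update s.reg r (s₁.reg 0) }) :
    Runs (.call r p args) s Q := by
  obtain ⟨n, s₁, h', hq⟩ := h
  exact ⟨_, _, .call _ _ _ _ _ _ _ hp h', hq⟩

end Runs

/-- The binders that have been reset stay so, since the field `5` of a record is only ever set to
the record itself. -/
theorem runs_resetBinders {t : Term} {Γ : List ℕ} {p : ℕ} {s : State}
    (h : Stored s.mem Γ p (s.reg 0) t) :
    Runs resetBinders s fun n s' => n ≤ 20 * t.size ∧ s'.next = s.next ∧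
      (∀ x g, g ≠ 5 → s'.mem x g = s.mem x g) ∧
      (∀ x, s'.mem x 5 = s.mem x 5 ∨ s'.mem x 5 = x) ∧
      ∀ i b, t.Free i → Γ[i]? = some b → s'.mem b 5 = b := by
  induction t generalizing Γ p s with
  | var i =>
    obtain ⟨h0, -, hi⟩ := h
    apply Runs.cons; apply Runs.load; apply Runs.cons; apply Runs.const; apply Runs.cons
    apply Runs.ifEq
    · intro _
      apply Runs.cons; apply Runs.load; apply Runs.cons; apply Runs.store; apply Runs.nil
      apply Runs.nil
      simp only [State.setReg, write_apply, Term.size, Term.Free]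
      refine ⟨by omega, trivial, by grind, by grind, ?_⟩
      rintro i b rfl hb
      simp_all
    · intro hne
      simp [State.setReg, h0] at hne
  | lam t ih =>
    obtain ⟨h0, -, hi⟩ := h
    apply Runs.cons; apply Runs.load; apply Runs.cons; apply Runs.const; apply Runs.cons
    apply Runs.ifEq
    · intro hne
      simp [State.setReg, h0] at hne
    · intro _
      apply Runs.cons; apply Runs.load; apply Runs.cons; apply Runs.call rfl
      refine (ih (by simpa [State.setReg] using hi)).mono ?_
      rintro n s' ⟨hn, hnext, hmem, hfix, hfree⟩
      apply Runs.cons; apply Runs.const; apply Runs.cons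
      apply Runs.ifEq
      · intro _
        apply Runs.skip; apply Runs.nil; apply Runs.nil
        simp only [State.setReg, Term.size] at *
        exact ⟨by omega, hnext, hmem, hfix, fun i b hi hb => hfree (i + 1) b hi hb⟩
      · intro hne
        simp [State.setReg, h0] at hne
  | app t u iht ihu | sub t u iht ihu =>
    obtain ⟨h0, -, ht, hu⟩ := h
    apply Runs.cons; apply Runs.load; apply Runs.cons; apply Runs.const; apply Runs.cons
    apply Runs.ifEq
    · intro hne
      simp [State.setReg, h0] at hne
    · intro _
      apply Runs.cons; apply Runs.load; apply Runs.cons; apply Runs.call rfl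
      refine (iht (by simpa [State.setReg] using ht)).mono ?_
      rintro n s' ⟨hn, hnext, hmem, hfix, hfree⟩
      apply Runs.cons; apply Runs.const; apply Runs.cons
      apply Runs.ifEq
      · intro hne
        simp [State.setReg, h0] at hne
      · intro _
        apply Runs.cons; apply Runs.load; apply Runs.cons; apply Runs.call rfl
        simp only [State.setReg] at hnext hmem hfix
        refine (ihu (Γ := Γ) (p := s.reg 0) ?_).mono ?_
        · simp only [State.setReg, List.map_cons, List.map_nil]
          refine Stored.frame (mem := s.mem) ?_ fun x _ g hg => hmem x g (by omega)
          simpa [hmem] using hu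
        · rintro m s'' ⟨hm, hnext', hmem', hfix', hfree'⟩
          apply Runs.nil; apply Runs.nil; apply Runs.nil
          simp only [State.setReg, Term.size] at *
          refine ⟨by omega, by omega, fun x g hg => (hmem' x g hg).trans (hmem x g hg),
            fun x => by grind, fun i b hi hb => ?_⟩
          rcases hi with hi | hi
          · have : s'.mem b 5 = b := by
              first
              | exact hfree i b hi hb
              | exact hfree (i + 1) b hi hb
            grind
          · exact hfree' i b hi hb

/-- The part of `copyTerm` before the case distinction. -/
theorem Runs.copyTerm_head {s : State} {Q : ℕ → State → Prop}
    (h : ∀ s₁ : State, s₁.next = s.next + 1 → s₁.reg 0 = s.reg 0 → s₁.reg 2 = s.next →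
      s₁.reg 3 = s.mem (s.reg 0) 0 → s₁.reg 4 = 0 →
      (∀ x g, s₁.mem x g = if x = s.reg 0 ∧ g = 5 then s.next else if x = s.next ∧ g = 3 then
        s.reg 1 else if x = s.next ∧ g = 0 then s.mem (s.reg 0) 0 else s.mem x g) →
      Runs (.block [.ifEq 3 4
        (.block [.load 5 0 4, .load 5 5 5, .store 2 4 5])
        (.block [.load 5 0 1, .call 6 2 [5, 2], .store 2 1 6, .const 4 1,
          .ifEq 3 4 .skip (.block [.load 5 0 2, .call 6 2 [5, 2], .store 2 2 6])]),
        .move 0 2]) s₁ fun n => Q (n + 6)) : Runs copyTerm s Q := by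
  apply Runs.cons; apply Runs.alloc; apply Runs.cons; apply Runs.load; apply Runs.cons
  apply Runs.store; apply Runs.cons; apply Runs.store; apply Runs.cons; apply Runs.store
  apply Runs.cons; apply Runs.const
  refine (h _ rfl ?_ rfl rfl rfl ?_).mono ?_
  · simp [State.setReg]
  · intro x g
    simp [State.setReg, write_apply]
  · intro n s' h
    convert h using 1
    ring

set_option maxHeartbeats 1000000 in
/-- In the copy of a term, a free variable that `Γ` represents by the record `x` is represented by
the field `5` of `x`. Apart from the fields `5` of the records of the original, the old memory does
not change. -/
theorem runs_copyTerm {t : Term} {Γ : List ℕ} {p a q : ℕ} {s : State}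
    (hr0 : s.reg 0 = a) (hr1 : s.reg 1 = q)
    (h : Stored s.mem Γ p a t) (hnd : (cells s.mem a t).Nodup)
    (hΓ : ∀ x ∈ Γ, x ∉ cells s.mem a t ∧ x < s.next) (hlt : ∀ x ∈ cells s.mem a t, x < s.next) :
    Runs copyTerm s fun n s' => n ≤ 30 * t.size ∧ s.next ≤ s'.next ∧
      (∀ x < s.next, ∀ g, g ≠ 5 ∨ x ∉ cells s.mem a t → s'.mem x g = s.mem x g) ∧
      Stored s'.mem (Γ.map fun x => s.mem x 5) q (s'.reg 0) t ∧
      (cells s'.mem (s'.reg 0) t).Nodup ∧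
      ∀ x ∈ cells s'.mem (s'.reg 0) t, s.next ≤ x ∧ x < s'.next := by
  induction t generalizing Γ p a q s with
  | var i =>
    obtain ⟨h0, -, hi⟩ := h
    have ha : a < s.next := hlt a (self_mem_cells _ _ _)
    apply Runs.copyTerm_head
    intro s₁ hnext hr0' hr2 hr3 hr4 hmem
    rw [hr0] at hr0' hr3 hmem
    have hb := hΓ _ (List.mem_of_getElem? hi)
    simp only [cells, List.mem_singleton] at hb
    apply Runs.cons
    apply Runs.ifEq
    · intro _
      apply Runs.cons; apply Runs.load; apply Runs.cons; apply Runs.load; apply Runs.cons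
      apply Runs.store; apply Runs.nil; apply Runs.cons; apply Runs.move; apply Runs.nil
      simp [State.setReg, write_apply, Term.size, Stored, cells, hr0', hr1, hr2, hnext, hi, hmem,
        h0]
      grind
    · intro hne
      rw [hr3, hr4, h0] at hne
      exact absurd rfl hne
  | lam t ih =>
    obtain ⟨h0, -, hi⟩ := h
    simp only [cells, List.nodup_cons, List.mem_cons, not_or, forall_eq_or_imp] at hnd hΓ hlt
    apply Runs.copyTerm_head
    intro s₁ hnext hr0' hr2 hr3 hr4 hmem
    rw [hr0] at hr0' hr3 hmem
    have hold : ∀ x < s.next, ∀ g, g ≠ 5 ∨ x ≠ a → s₁.mem x g = s.mem x g := by grind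
    have hw : s₁.mem s.next 0 = 1 ∧ s₁.mem s.next 3 = q := by grind
    have hs₁ : ∀ x ∈ cells s.mem (s.mem a 1) t, ∀ g, s₁.mem x g = s.mem x g :=
      fun x hx g => hold x (hlt.2 x hx) g (.inr (by rintro rfl; exact hnd.1 hx))
    have hc₁ : cells s₁.mem (s.mem a 1) t = cells s.mem (s.mem a 1) t :=
      cells_congr fun x hx => ⟨hs₁ x hx 1, hs₁ x hx 2⟩
    have ha1 : s₁.mem a 1 = s.mem a 1 := by grind
    have ha5 : s₁.mem a 5 = s.next := by grind
    clear hmem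
    have hΓ₁ : (a :: Γ).map (fun x => s₁.mem x 5) = s.next :: Γ.map (fun x => s.mem x 5) := by
      rw [List.map_cons, ha5, List.map_congr_left fun x hx => hold x (hΓ x hx).2 5 ?_]
      exact .inr (hΓ x hx).1.1
    apply Runs.cons
    apply Runs.ifEq
    · intro hne
      rw [hr3, hr4, h0] at hne
      exact absurd hne (by omega)
    · intro _
      apply Runs.cons; apply Runs.load; apply Runs.cons; apply Runs.call rfl
      refine (ih (Γ := a :: Γ) (p := a) (a := s.mem a 1) (q := s.next) ?_ ?_ ?_ ?_ ?_ ?_).mono ?_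
      · simp [State.setReg, hr0', ha1]
      · simp [State.setReg, hr2]
      · exact hi.frame fun x hx g _ => hs₁ x hx g
      · simpa only [State.setReg, hc₁] using hnd.2
      · simp only [State.setReg, hc₁, hnext]
        grind
      · simp only [State.setReg, hc₁, hnext]
        grind
      simp only [State.setReg, hc₁, hnext, hΓ₁]
      rintro n s₂ ⟨hn, hnext₂, hmem₂, hst, hnd₂, hlt₂⟩
      apply Runs.cons; apply Runs.store; apply Runs.cons; apply Runs.const; apply Runs.cons
      apply Runs.ifEq
      · intro _
        apply Runs.skip; apply Runs.nil; apply Runs.cons; apply Runs.move; apply Runs.nil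
        set w := s₂.reg 0
        obtain ⟨mem₃, hmem₃⟩ : ∃ m, m = write s₂.mem s.next 1 w := ⟨_, rfl⟩
        have hm₃ : ∀ x g, x ≠ s.next ∨ g ≠ 1 → mem₃ x g = s₂.mem x g := by
          intro x g hx
          rw [hmem₃, write_apply, if_neg (by tauto)]
        have hw₃ : mem₃ s.next 1 = w := by simp [hmem₃, write_apply]
        have hwt : ∀ x ∈ cells s₂.mem w t, ∀ g, mem₃ x g = s₂.mem x g := by grind
        have hcw := cells_congr fun x hx => ⟨hwt x hx 1, hwt x hx 2⟩
        simp [State.setReg, hr2, Term.size, Stored, cells, ← hmem₃, hw₃, hcw]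
        refine ⟨by omega, by omega, by grind, ⟨by grind, by grind,
          hst.frame fun x hx g _ => hwt x hx g⟩, by grind, by grind, by grind⟩
      · intro hne
        simp [State.setReg, hr3, h0] at hne
  | app t u iht ihu | sub t u iht ihu =>
    obtain ⟨h0, -, ht, hu⟩ := h
    simp only [cells, List.nodup_cons, List.nodup_append, List.mem_cons, List.mem_append, not_or,
      forall_eq_or_imp] at hnd hΓ hlt
    apply Runs.copyTerm_head
    intro s₁ hnext hr0' hr2 hr3 hr4 hmem
    rw [hr0] at hr0' hr3 hmem
    have hold : ∀ x < s.next, ∀ g, g ≠ 5 ∨ x ≠ a → s₁.mem x g = s.mem x g := by grind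
    have hw : s₁.mem s.next 0 = s.mem a 0 ∧ s₁.mem s.next 3 = q := by grind
    have hs₁ : ∀ x, x ∈ cells s.mem (s.mem a 1) t ∨ x ∈ cells s.mem (s.mem a 2) u →
        ∀ g, s₁.mem x g = s.mem x g :=
      fun x hx g => hold x (hlt.2 x hx) g (.inr (by rintro rfl; exact not_or.2 hnd.1 hx))
    have hct : cells s₁.mem (s.mem a 1) t = cells s.mem (s.mem a 1) t :=
      cells_congr fun x hx => ⟨hs₁ x (.inl hx) 1, hs₁ x (.inl hx) 2⟩
    have ha1 : s₁.mem a 1 = s.mem a 1 := by grind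
    have ha2 : s₁.mem a 2 = s.mem a 2 := by grind
    have ha5 : s₁.mem a 5 = s.next := by grind
    clear hmem
    have hmap₁ : Γ.map (fun x => s₁.mem x 5) = Γ.map (fun x => s.mem x 5) :=
      List.map_congr_left fun x hx => hold x (hΓ x hx).2 5 (.inr (hΓ x hx).1.1)
    have ht₁ := ht.frame fun x hx g _ => hs₁ x (.inl hx) g
    apply Runs.cons
    apply Runs.ifEq
    · intro hne
      rw [hr3, hr4, h0] at hne
      exact absurd hne (by omega)
    intro _
    apply Runs.cons; apply Runs.load; apply Runs.cons; apply Runs.call rfl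
    refine (iht (a := s.mem a 1) (q := s.next) ?_ ?_ (by exact ht₁) ?_ ?_ ?_).mono ?_
    · simp [State.setReg, hr0', ha1]
    · simp [State.setReg, hr2]
    · simpa only [State.setReg, hct] using hnd.2.1
    · simp only [State.setReg, hct, hnext]
      grind
    · simp only [State.setReg, hct, hnext]
      grind
    simp only [State.setReg, hct, hnext, List.map_cons, ha5, hmap₁]
    rintro n s₂ ⟨hn, hnext₂, hmem₂, hst, hnd₂, hlt₂⟩
    apply Runs.cons; apply Runs.store; apply Runs.cons; apply Runs.const; apply Runs.cons
    apply Runs.ifEq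
    · intro hne
      simp [State.setReg, hr3, h0] at hne
    intro _
    -- The record `s.next` of the copy, with the copy `w₁` of the left subterm attached.
    set w₁ := s₂.reg 0
    obtain ⟨mem₃, hmem₃⟩ : ∃ m, m = write s₂.mem s.next 1 w₁ := ⟨_, rfl⟩
    have hm₃ : ∀ x g, x ≠ s.next ∨ g ≠ 1 → mem₃ x g = s₂.mem x g := by
      intro x g hx
      rw [hmem₃, write_apply, if_neg (by tauto)]
    have hw₃ : mem₃ s.next 1 = w₁ := by simp [hmem₃, write_apply]
    simp only [State.setReg, hr2, Function.update_apply, Nat.reduceEqDiff, if_true, if_false,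
      ← hmem₃]
    clear hmem₃
    have hcu₃ : ∀ x ∈ cells s.mem (s.mem a 2) u, ∀ g, mem₃ x g = s.mem x g := by grind
    have hcu : cells mem₃ (s.mem a 2) u = cells s.mem (s.mem a 2) u :=
      cells_congr fun x hx => ⟨hcu₃ x hx 1, hcu₃ x hx 2⟩
    have ha2' : mem₃ a 2 = s.mem a 2 := by grind
    have hmap₃ : Γ.map (fun x => mem₃ x 5) = Γ.map (fun x => s.mem x 5) :=
      List.map_congr_left fun x hx => by grind
    have hu₁ := hu.frame fun x hx g _ => hcu₃ x hx g
    apply Runs.cons; apply Runs.load; apply Runs.cons; apply Runs.call rfl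
    refine (ihu (a := s.mem a 2) (q := s.next) ?_ ?_ (by exact hu₁) ?_ ?_ ?_).mono ?_
    · simp [State.setReg, hr0', ha2']
    · simp [State.setReg, hr2]
    · simpa only [State.setReg, hcu] using hnd.2.2.1
    · simp only [State.setReg, hcu]
      grind
    · simp only [State.setReg, hcu]
      grind
    simp only [State.setReg, hcu, hmap₃]
    rintro m s₄ ⟨hm, hnext₄, hmem₄, hst₄, hnd₄, hlt₄⟩
    apply Runs.cons; apply Runs.store; apply Runs.nil; apply Runs.nil; apply Runs.cons
    apply Runs.move; apply Runs.nil
    set w₂ := s₄.reg 0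
    obtain ⟨mem₅, hmem₅⟩ : ∃ m, m = write s₄.mem s.next 2 w₂ := ⟨_, rfl⟩
    have hm₅ : ∀ x g, x ≠ s.next ∨ g ≠ 2 → mem₅ x g = s₄.mem x g := by
      intro x g hx
      rw [hmem₅, write_apply, if_neg (by tauto)]
    have hw₅ : mem₅ s.next 2 = w₂ := by simp [hmem₅, write_apply]
    have hw₅' : mem₅ s.next 1 = w₁ := by grind
    -- Copying the right subterm does not touch the copy of the left one.
    have hwt : ∀ x ∈ cells s₂.mem w₁ t, ∀ g, mem₅ x g = s₂.mem x g := by grind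
    have hwu : ∀ x ∈ cells s₄.mem w₂ u, ∀ g, mem₅ x g = s₄.mem x g := by grind
    have hcwt := cells_congr fun x hx => ⟨hwt x hx 1, hwt x hx 2⟩
    have hcwu := cells_congr fun x hx => ⟨hwu x hx 1, hwu x hx 2⟩
    simp [State.setReg, hr2, Term.size, Stored, cells, ← hmem₅, hw₅, hw₅', hcwt, hcwu,
      List.nodup_append]
    refine ⟨by omega, by omega, by grind, ⟨by grind, by grind,
      hst.frame fun x hx g _ => hwt x hx g, hst₄.frame fun x hx g _ => hwu x hx g⟩, by grind,
      by grind, by grind⟩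

/-! ### The program implements all redexes -/

theorem implements_db (C : Ctx) (L : List Term) (r p : Term) :
    Implements program (Redex.db C L r p) 30 := by
  intro s root Γ h
  obtain ⟨a, l, p₁, f₁, hhandles, htag, hpar, hslot, htarget⟩ := h.db
  rw [hhandles]
  suffices Runs (.call 0 0 [0, 1]) { s with reg := fun i => [a, l].getD i 0 } fun m s' =>
      m ≤ 30 ∧ Represents s' root Γ (Redex.db C L r p).target by
    obtain ⟨m, s', h, hm, hr⟩ := this
    exact ⟨m, s', hm, h, hr⟩
  apply Runs.call rfl
  apply Runs.cons; apply Runs.load; apply Runs.cons; apply Runs.const; apply Runs.cons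
  apply Runs.ifEq
  · intro hne
    simp [State.setReg, htag] at hne
  intro _
  apply Runs.cons; apply Runs.load; apply Runs.cons; apply Runs.load; apply Runs.cons
  apply Runs.load; apply Runs.cons; apply Runs.load; apply Runs.cons
  have key (s₁ : State) (h1 : s₁.reg 1 = l)
      (h2 : s₁.reg 2 = p₁) (h3 : s₁.reg 3 = s.mem a 1) (h4 : s₁.reg 4 = s.mem a 2)
      (hn : s₁.next = s.next) (hmem : s₁.mem = write s.mem p₁ f₁ (s.mem a 1)) :
      Runs (.block [.store 3 3 2, .const 6 3, .store 1 0 6, .store 1 2 4, .store 4 3 1]) s₁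
        fun n s' => n ≤ 10 ∧ Represents s' root Γ (Redex.db C L r p).target := by
    apply Runs.cons; apply Runs.store; apply Runs.cons; apply Runs.const; apply Runs.cons
    apply Runs.store; apply Runs.cons; apply Runs.store; apply Runs.cons; apply Runs.store
    apply Runs.nil
    refine ⟨by omega, htarget _ hn ?_⟩
    simp [State.setReg, h1, h2, h3, h4, hmem]
  apply Runs.ifEq
  · intro heq
    simp [State.setReg, hpar] at heq
    obtain ⟨rfl, -⟩ : f₁ = 1 ∧ _ := hslot.resolve_right fun h => h.2 heq
    apply Runs.store
    refine (key _ ?_ ?_ ?_ ?_ ?_ ?_).mono ?_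
    on_goal 7 => exact fun n s' h => Runs.nil ⟨by omega, h.2⟩
    all_goals simp [State.setReg, hpar]
  · intro hne
    simp [State.setReg, hpar] at hne
    obtain ⟨rfl, -⟩ : f₁ = 2 ∧ _ := hslot.resolve_left fun h => hne h.2
    apply Runs.store
    refine (key _ ?_ ?_ ?_ ?_ ?_ ?_).mono ?_
    on_goal 7 => exact fun n s' h => Runs.nil ⟨by omega, h.2⟩
    all_goals simp [State.setReg, hpar]

theorem implements_ls (D E : Ctx) (u : Term) :
    Implements program (Redex.ls D E u) (80 * u.size) := by
  intro s root Γ h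
  obtain ⟨x, b, p₂, f₂, Γ₁, hhandles, htag, hb, hpar, hslot, hu, hnd, hΓ, hlt, hx, hp₂, htarget⟩ :=
    h.ls
  rw [hhandles]
  -- The constant overhead `30` is absorbed by the size of `u`.
  have hpos : 1 ≤ u.size := by cases u <;> simp [Term.size]
  suffices Runs (.call 0 0 [0, 1]) { s with reg := fun i => [x].getD i 0 } fun m s' =>
      m ≤ 50 * u.size + 30 ∧ Represents s' root Γ (Redex.ls D E u).target by
    obtain ⟨m, s', h, hm, hr⟩ := this
    exact ⟨m, s', by omega, h, hr⟩
  apply Runs.call rfl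
  apply Runs.cons; apply Runs.load; apply Runs.cons; apply Runs.const; apply Runs.cons
  apply Runs.ifEq
  swap
  · intro hne
    simp [State.setReg, htag] at hne
  intro _
  apply Runs.cons; apply Runs.load; apply Runs.cons; apply Runs.load; apply Runs.cons
  apply Runs.call rfl
  refine (runs_resetBinders (t := u) (Γ := Γ₁) (p := b) ?_).mono ?_
  · simpa [State.setReg, hb] using hu
  rintro n s₁ ⟨hn, hnext₁, hmem₁, -, hfree⟩
  simp only [State.setReg] at hnext₁ hmem₁
  apply Runs.cons; apply Runs.load; apply Runs.cons
  apply Runs.call rfl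
  have hc₁ : cells s₁.mem (s.mem b 2) u = cells s.mem (s.mem b 2) u :=
    cells_congr fun y _ => ⟨hmem₁ y 1 (by omega), hmem₁ y 2 (by omega)⟩
  refine (runs_copyTerm (t := u) (Γ := Γ₁) (p := b) (a := s.mem b 2) (q := p₂)
    ?_ ?_ ?_ ?_ ?_ ?_).mono ?_
  · simp [State.setReg, hb]
  · simp [State.setReg, hmem₁, hpar]
  · exact hu.frame fun y _ g hg => hmem₁ y g (by omega)
  · simpa only [State.setReg, hc₁] using hnd
  · simpa only [State.setReg, hc₁, hnext₁] using hΓ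
  · simpa only [State.setReg, hc₁, hnext₁] using hlt
  rintro m s₂ ⟨hm, hnext₂, hmem₂, hst, hnd₂, hlt₂⟩
  simp only [State.setReg, hnext₁] at hnext₂ hmem₂ hst hlt₂
  set w := s₂.reg 0 with hw
  -- The field `5` of the binder of a free variable of `u` refers to the binder itself.
  have hst' : Stored s₂.mem Γ₁ p₂ w u := by
    refine hst.congr_env fun i hi => ?_
    rw [List.getElem?_map]
    cases hg : Γ₁[i]? with
    | none => rfl
    | some c => simp [hfree i c hi hg]
  have hold : ∀ y < s.next, ∀ g < 5, s₂.mem y g = s.mem y g := fun y hy g hg =>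
    (hmem₂ y hy g (.inl (by omega))).trans (hmem₁ y g (by omega))
  have hp1 : s₂.mem p₂ 1 = s.mem p₂ 1 := hold p₂ hp₂ 1 (by omega)
  have hp3 : s₁.mem x 3 = p₂ := by rw [hmem₁ x 3 (by omega), hpar]
  apply Runs.cons; apply Runs.load; apply Runs.cons
  apply Runs.ifEq
  · intro heq
    simp [State.setReg, hp1, hp3] at heq
    obtain ⟨rfl, -⟩ : f₂ = 1 ∧ _ := hslot.resolve_right fun h => h.2 heq
    apply Runs.store; apply Runs.nil; apply Runs.nil
    refine ⟨by omega, htarget _ s₂.mem w hnext₂ hold hst' hnd₂ hlt₂ ?_⟩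
    simp [State.setReg, hp3]
  · intro hne
    simp [State.setReg, hp1, hp3] at hne
    obtain ⟨rfl, -⟩ : f₂ = 2 ∧ _ := hslot.resolve_left fun h => hne h.2
    apply Runs.store; apply Runs.nil; apply Runs.nil
    refine ⟨by omega, htarget _ s₂.mem w hnext₂ hold hst' hnd₂ hlt₂ ?_⟩
    simp [State.setReg, hp3]

end LSC

theorem mainTheorem9 :
    -- Invariant: box subterms to the right of the last contracted redex are box subterms of `t`.
    (∀ (t : Term) (ρ : List Redex) (R : Redex) (u : Term),
      IsDerivation t (ρ ++ [R]) u → Standard (ρ ++ [R]) →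
      ∀ (B : Ctx) (v : Term), B.IsBox → B.plug v = u → R.position.LO B →
        v.erase.BoxSubterm t.erase) ∧
    -- Standard derivations have the subterm property.
    (∀ (t : Term) (ρ : List Redex) (u : Term),
      IsDerivation t ρ u → Standard ρ → SubtermProperty t ρ) ∧
    -- Leftmost-outermost useful derivations have the subterm property.
    (∀ (t : Term) (ρ : List Redex) (u : Term),
      IsDerivation t ρ u → LOUDerivation ρ → SubtermProperty t ρ) ∧
    -- Linear size.
    (∀ (t : Term) (ρ : List Redex) (u : Term),
      IsDerivation t ρ u → SubtermProperty t ρ ∨ Standard ρ ∨ LOUDerivation ρ →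
        u.size ≤ (ρ.length + 1) * t.size) ∧
    -- Linear step: one program, one constant.
    (∃ (P : List Cmd) (c : ℕ),
      (∀ (t : Term) (ρ : List Redex) (u : Term),
        IsDerivation t ρ u → SubtermProperty t ρ ∨ Standard ρ ∨ LOUDerivation ρ →
          ∀ R ∈ ρ, Implements P R (c * t.size)) ∧
      (∀ (t : Term) (ρ : List Redex) (u : Term),
        IsDerivation t ρ u → LOUDerivation ρ →
          ∀ R : Redex, R.IsLOU → R.source = u → Implements P R (c * t.size))) := by
  have hsub {t : Term} {ρ : List Redex} {u : Term} (h : IsDerivation t ρ u)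
      (h' : SubtermProperty t ρ ∨ Standard ρ ∨ LOUDerivation ρ) : SubtermProperty t ρ := by
    rcases h' with h' | h' | h'
    · exact h'
    · exact h'.subtermProperty h
    · exact (h'.standard h).subtermProperty h
  have hstep {t : Term} {ρ : List Redex} {u : Term} (h : IsDerivation t ρ u)
      (h' : SubtermProperty t ρ ∨ Standard ρ ∨ LOUDerivation ρ) (R : Redex) (hR : R ∈ ρ) :
      Implements program R (80 * t.size) := by
    have mono {m n : ℕ} (hmn : m ≤ n) (h : Implements program R m) : Implements program R n := by
      intro s root Γ hr
      obtain ⟨k, s', hk, hk'⟩ := h s root Γ hr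
      exact ⟨k, s', hk.trans hmn, hk'⟩
    cases R with
    | db C L r p =>
      refine mono ?_ (implements_db C L r p)
      have : 1 ≤ t.size := by cases t <;> simp [Term.size]
      omega
    | ls D E v =>
      exact mono (Nat.mul_le_mul_left _ ((hsub h h').size_content_le hR)) (implements_ls D E v)
  refine ⟨?_, fun t ρ u h h' => h'.subtermProperty h, fun t ρ u h h' => hsub h (.inr (.inr h')),
    fun t ρ u h h' => (hsub h h').size_le h, program, 80, fun t ρ u h h' => hstep h h',
    fun t ρ u h h' R hR hRu => ?_⟩
  · intro t ρ R u h h' B v hB hv hlt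
    refine Term.boxSubterm_of_mem_boxes (h'.boxesAfter_subset h (R.boxesAfter_after_subset ?_))
    refine Ctx.erase_mem_boxesAfter ?_ hB hlt
    rw [← R.target_eq, hv, h.snoc_inv.2.2]
  · -- An LOU redex of `u` extends the derivation by one LOU step.
    have happ : IsDerivation t (ρ ++ [R]) R.target := by
      subst hRu
      clear h'
      generalize hm : R.source = m at h
      induction h with
      | nil t => exact .cons _ _ _ _ hR.1 hm (.nil _)
      | cons t u S ρ hs he _ ih => exact .cons _ _ _ _ hs he (ih hm)
    refine hstep happ (.inr (.inr fun S hS => ?_)) R (by simp)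
    rcases List.mem_append.1 hS with hS | hS
    · exact h' S hS
    · rwa [List.mem_singleton.1 hS]
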